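/- A flow over time network $\mathcal N=(D=(V,A),u,\tau,S^+,S^-)$ consists of a finite directed graph $D$ (parallel arcs and loops allowed), arc capacities $u\in\mathbb R_{\ge 0}^A$, arc transit times $\tau\in\mathbb R_{\ge 0}^A$, and disjoint sets $S^+,S^-\subseteq V$ of sources and sinks. Let $W:=S^+\cup S^-$ be the set of terminals, $m:=|A|$ and $k:=|W|$. Let $b:W\to\mathbb R$ be a supply/demand function, i.e. $b\ge 0$ on $S^+$, $b\le 0$ on $S^-$ and $\sum_{v\in W}b(v)=0$, and put $b(S):=\sum_{v\in S}b(v)$ for $S\subseteq W$. For $S\subseteq W$ and $\theta\ge 0$ let $o^\theta(S)$ be the maximum amount of flow that a flow over time with time horizon $\theta$ in $\mathcal N$ can send from the sources in $S^+\cap S$ to the sinks in $S^-\setminus S$ (continuous time: at every time the rate at which flow enters arc $a$ is at most $u_a$, this flow leaves $a$ exactly $\tau_a$ time units later and no later than time $\theta$, and flow is conserved at all other nodes). Put $$d^\theta(S):=o^\theta(S)-b(S),\qquad d(\theta):=\min_{S\subseteq W}d^\theta(S),$$ and let $\operatorname{cut}^\theta(S)$ be the left-hand derivative at time $\theta$ of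 the piecewise linear convex function $t\mapsto d^t(S)$ on $[0,\infty)$; a breakpoint of this function is a point $t>0$ near which it is not affine. The Generalized Discrete Newton Algorithm, run on $(\mathcal N,b)$, starts with $i:=0$, $\theta_0:=0$ and $J:=\{2^0,2^1,\dots,2^{\lceil\log_2(k^2/4)\rceil}\}$. While $d(\theta_i)<0$ it performs iteration $i$: it chooses an arbitrary minimizer $S_i$ of $d^{\theta_i}$ over the subsets of $W$, sets $\theta_i':=\min\{\theta\ge 0: d^\theta(S_i)=0\}$ and $$\theta_{i+1}:=\max\Bigl(\{\theta_i'\}\cup\Bigl\{\theta=\theta_i'+j\cdot\tfrac{-d(\theta_i')}{\operatorname{cut}^{\theta_i'}(S_i)}\;:\;d(\theta)<0,\ j\in J\Bigr\}\Bigr),$$ and increases $i$ by one. Let $j_i:=0$ if $\theta_{i+1}=\theta_i'$, and otherwise let $j_i\in J$ be the value of $j$ that attains the maximum. Let $I$ be the set of iterations and $$I^1:=\{i\in I: j_i=2^{\lceil\log_2(k^2/4)\rceil}\},$$ $$I^2:=\{i\in I\setminus I^1: t\mapsto d^t(S)\text{ has a breakpoint in }[\theta_i,\theta_{i+1}]\text{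 for some }S\subseteq W\},$$ $$I^3:=I\setminus(I^1\cup I^2).$$ Then $|I^3|\in O(k^2\log k+m\log m\log k)$. That is, there is an absolute constant $C$ such that, for all networks $\mathcal N$, all supply/demand functions $b$ and all executions of the algorithm on $(\mathcal N,b)$, the set $I^3$, formed from the first $K$ iterations for any $K$ (in particular from all iterations of a terminating execution), satisfies $$|I^3|\le C\,(k^2\log k+m\log m\log k),$$ where $0\log 0:=0$. -/

import Mathlib

open MeasureTheory Set

noncomputable section

namespace QuickestTransshipment

/-- A flow over time network with node type `V` and arc type `A` (parallel arcs and loops allowed):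
non-negative real arc capacities and transit times, and disjoint sets of sources and sinks. -/
structure Network (V A : Type*) where
  src : A → V
  tgt : A → V
  cap : A → ℝ
  cap_nonneg : ∀ a, 0 ≤ cap a
  transit : A → ℝ
  transit_nonneg : ∀ a, 0 ≤ transit a
  sources : Finset V
  sinks : Finset V
  disjoint : Disjoint sources sinks

namespace Network

variable {V A : Type*} [DecidableEq V] [Fintype A]

/-- The set of terminals. -/
def terminals (N : Network V A) : Finset V := N.sources ∪ N.sinks

/-- `b` is a supply/demand function on the terminals (its values elsewhere are never used). -/
structure IsSupply (N : Network V A) (b : V → ℝ) : Prop where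
  nonneg : ∀ v ∈ N.sources, 0 ≤ b v
  nonpos : ∀ v ∈ N.sinks, b v ≤ 0
  balanced : ∑ v ∈ N.terminals, b v = 0

/-- The net rate at which flow leaves the node `v` at time `t`, where `f a t` is the rate at
which flow enters the arc `a` at time `t`, to leave it at time `t + transit a`. -/
def netOut (N : Network V A) (f : A → ℝ → ℝ) (v : V) (t : ℝ) : ℝ :=
  (∑ a with N.src a = v, f a t) - ∑ a with N.tgt a = v, f a (t - N.transit a)

/-- `f` is a flow over time with time horizon `θ` that sends flow from the nodes in `X` to the
nodes in `Y`: no flow remains on an arc after time `θ`, capacities are respected, flow is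
conserved at all other nodes, nodes in `X` only feed flow into the network and nodes in `Y` only
take flow out of it. (Equivalently: an `s`-`t`-flow over time after a super source `s` has been
connected to the nodes in `X`, and the nodes in `Y` to a super sink `t`, by arcs of infinite
capacity and zero transit time.) -/
structure IsFlowOverTime (N : Network V A) (X Y : Finset V) (θ : ℝ) (f : A → ℝ → ℝ) : Prop where
  measurable : ∀ a, Measurable (f a)
  nonneg : ∀ a t, 0 ≤ f a t
  le_cap : ∀ a t, f a t ≤ N.cap a
  support : ∀ a t, t ∉ Icc 0 (θ - N.transit a) → f a t = 0
  conservation : ∀ v, v ∉ X → v ∉ Y → ∀ᵐ t : ℝ, N.netOut f v t = 0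
  source : ∀ v ∈ X, ∀ᵐ t : ℝ, 0 ≤ N.netOut f v t
  sink : ∀ v ∈ Y, ∀ᵐ t : ℝ, N.netOut f v t ≤ 0

/-- The total amount of flow that arrives at the nodes in `Y`. -/
def flowValue (N : Network V A) (Y : Finset V) (f : A → ℝ → ℝ) : ℝ :=
  ∑ v ∈ Y, ∫ t : ℝ, -N.netOut f v t

/-- `o^θ(S)`: the maximum amount of flow that can be sent from the sources in `S` to the sinks
outside `S` within time horizon `θ`. -/
def maxFlow (N : Network V A) (θ : ℝ) (S : Finset V) : ℝ :=
  sSup {x | ∃ f, N.IsFlowOverTime (N.sources ∩ S) (N.sinks \ S) θ f ∧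
    x = N.flowValue (N.sinks \ S) f}

/-- `d^θ(S) = o^θ(S) - b(S)`. -/
def slack (N : Network V A) (b : V → ℝ) (θ : ℝ) (S : Finset V) : ℝ :=
  N.maxFlow θ S - ∑ v ∈ S, b v

/-- `d(θ)`: the minimum of `d^θ(S)` over all sets `S` of terminals. -/
def minSlack (N : Network V A) (b : V → ℝ) (θ : ℝ) : ℝ :=
  N.terminals.powerset.inf' ⟨∅, Finset.empty_mem_powerset _⟩ (fun S => N.slack b θ S)

/-- `cut^θ(S)`: the left-hand derivative of `t ↦ d^t(S)` at time `θ`. -/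
def cut (N : Network V A) (b : V → ℝ) (θ : ℝ) (S : Finset V) : ℝ :=
  derivWithin (fun t => N.slack b t S) (Iic θ) θ

/-- The number `k` of terminals. -/
def numTerminals (N : Network V A) : ℕ := N.terminals.card

/-- The exponent `⌈log₂ (k² / 4)⌉` of the largest element of the set `J` of jump lengths (cut off
at `0`, which matters only for `k ≤ 1`, where the algorithm makes no iteration at all). -/
def maxExponent (N : Network V A) : ℕ := ⌈Real.logb 2 ((N.numTerminals : ℝ) ^ 2 / 4)⌉₊

/-- The time `θ' + j * (-d(θ') / cut^{θ'}(S))`. -/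
def jump (N : Network V A) (b : V → ℝ) (θ' : ℝ) (S : Finset V) (j : ℝ) : ℝ :=
  θ' + j * (-N.minSlack b θ' / N.cut b θ' S)

/-- The set of times of which the second update of an iteration takes the maximum: `θ'` and all
infeasible times among `jump θ' S j` for `j ∈ J = {2^0, 2^1, …, 2^⌈log₂ (k² / 4)⌉}`. -/
def candidates (N : Network V A) (b : V → ℝ) (θ' : ℝ) (S : Finset V) : Set ℝ :=
  {θ'} ∪ {t | N.minSlack b t < 0 ∧ ∃ r ≤ N.maxExponent, t = N.jump b θ' S (2 ^ r)}

/-- The first `K` iterations `0, …, K - 1` of some execution of the Generalized Discrete Newton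
Algorithm on `(N, b)`. Iteration `i` starts at time `θ i` with `d(θ i) < 0`, picks any minimizer
`S i` of `d^{θ i}`, moves to the first zero `θ' i` of `t ↦ d^t(S i)` and then to `θ (i + 1)`.
(A terminated execution with `K` iterations is one that satisfies also `0 ≤ d(θ K)`.) -/
structure IsExecution (N : Network V A) (b : V → ℝ) (K : ℕ)
    (θ θ' : ℕ → ℝ) (S : ℕ → Finset V) : Prop where
  init : θ 0 = 0
  guard : ∀ i < K, N.minSlack b (θ i) < 0
  subset : ∀ i < K, S i ⊆ N.terminals
  minimizer : ∀ i < K, N.slack b (θ i) (S i) = N.minSlack b (θ i)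
  first_zero : ∀ i < K, IsLeast {t | 0 ≤ t ∧ N.slack b t (S i) = 0} (θ' i)
  next : ∀ i < K, IsGreatest (N.candidates b (θ' i) (S i)) (θ (i + 1))

/-- `t` is a breakpoint of the piecewise linear function `f` on `[0, ∞)`. -/
def IsBreakpoint (f : ℝ → ℝ) (t : ℝ) : Prop :=
  0 < t ∧ ¬ ∃ p q : ℝ, ∀ᶠ x in nhds t, f x = p * x + q

/-- `I¹`: the iterations in which the second update makes the longest possible jump. -/
def iterations1 (N : Network V A) (b : V → ℝ) (K : ℕ)
    (θ θ' : ℕ → ℝ) (S : ℕ → Finset V) : Set ℕ :=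
  {i | i < K ∧ θ (i + 1) ≠ θ' i ∧ θ (i + 1) = N.jump b (θ' i) (S i) (2 ^ N.maxExponent)}

/-- `I²`: the iterations outside `I¹` that meet a breakpoint of `t ↦ d^t(T)` for some set `T` of
terminals. -/
def iterations2 (N : Network V A) (b : V → ℝ) (K : ℕ)
    (θ θ' : ℕ → ℝ) (S : ℕ → Finset V) : Set ℕ :=
  {i | i < K ∧ i ∉ N.iterations1 b K θ θ' S ∧ ∃ T ⊆ N.terminals,
    ∃ t ∈ Icc (θ i) (θ (i + 1)), IsBreakpoint (fun x => N.slack b x T) t}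

/-- `I³`: all other iterations. -/
def iterations3 (N : Network V A) (b : V → ℝ) (K : ℕ)
    (θ θ' : ℕ → ℝ) (S : ℕ → Finset V) : Set ℕ :=
  {i | i < K} \ (N.iterations1 b K θ θ' S ∪ N.iterations2 b K θ θ' S)

end Network

end QuickestTransshipment

end

/-!
The proof bounds the number of all iterations, by a window argument that rests on properties of
`d^θ(S)` as a function of `θ` and of `S`.

*Duality.* The maximum flow over time `o^θ(S)` is the least capacity `dualCost p` of a cut over
time, given by a potential `p` with value `0` at the sources in `S` and `θ` at the sinks outside
`S`. Weak duality (`IsFlowOverTime.flowValue_le_dualCost`) integrates the flow balance of each node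
`v` up to time `p v`. For strong duality (`exists_dualCost_le_flowValue`), Sion's minimax theorem
gives a saddle point of a potential and a static flow, and a temporally repeated flow attains its
value (`exists_isFlowOverTime_of_static`). The dual description shows that `o^θ(S)` is convex in `θ`
and submodular in `S`. It also shows that each breakpoint is a combination of the transit times with
integer coefficients of absolute value at most `3` (`IsBreakpoint.exists_eq_sum`): some minimum cut
consists of times `y · τ` or `y · τ + θ` with small `y`, and for all other `θ` this cut moves
linearly with `θ`, so that its capacity is affine and touches the convex function `o` from above.

*Remaining time.* After an iteration outside `I¹` the remaining time is at most half of what it was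
(`IsExecution.two_mul_sub_le`), because the next longer jump would have been feasible. Hence the
breakpoints met in `I²` have geometrically decreasing distances. As these are small integral
combinations of the transit times, a pigeonhole argument (`two_pow_le_of_geometric`) gives `|I²| =
O(m log m)`.

*Ring families.* At time `θ_l`, all sets `S_j` with `j ≥ l` have nonpositive slack. By
submodularity, a set in the ring family that they generate has slack less than `(k² / 4) *
(-d(θ_l))` (`IsExecution.slack_le_of_separated`). The ring family is encoded by the at most `k²`
pairs of terminals that its generators separate, so it can shrink at most `k²` times. It shrinks at
each iteration in `I¹`. It also shrinks during each run of `O(log k)` consecutive iterations in `I³`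
(`IsExecution.separated_ne_of_run`): without breakpoints the slopes decrease as in the usual
discrete Newton method while the remaining time is halved, so that the slack of the first set of the
run becomes too large.

Therefore each window of `O(log k)` iterations contains one of `O(k² + m log m)` exceptional
iterations.
-/

noncomputable section

namespace QuickestTransshipment

namespace Network

variable {V A : Type*} [DecidableEq V] [Fintype A]

/-! ### Weak duality -/

/-- A function `p` on the nodes is a potential for the horizon `θ` if it vanishes on `X` and equals
`θ` on `Y`: in the generalized cut that it describes, the node `v` changes sides at time `p v`. -/
def IsPotential (X Y : Finset V) (θ : ℝ) (p : V → ℝ) : Prop :=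
  (∀ v ∈ X, p v = 0) ∧ ∀ v ∈ Y, p v = θ

/-- The capacity of the cut over time described by `p`: the arc `a` crosses it during a time
interval of length `(p (tgt a) - p (src a) - τ a)⁺`. -/
def dualCost (N : Network V A) (p : V → ℝ) : ℝ :=
  ∑ a, N.cap a * max 0 (p (N.tgt a) - p (N.src a) - N.transit a)

lemma sum_sum_src [Fintype V] (N : Network V A) (g : V → A → ℝ) :
    ∑ v, ∑ a with N.src a = v, g v a = ∑ a, g (N.src a) a := by
  rw [← Finset.sum_fiberwise Finset.univ N.src]
  refine Finset.sum_congr rfl fun v _ => Finset.sum_congr rfl fun a ha => ?_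
  simp only [Finset.mem_filter] at ha
  rw [ha.2]

lemma sum_sum_tgt [Fintype V] (N : Network V A) (g : V → A → ℝ) :
    ∑ v, ∑ a with N.tgt a = v, g v a = ∑ a, g (N.tgt a) a := by
  rw [← Finset.sum_fiberwise Finset.univ N.tgt]
  refine Finset.sum_congr rfl fun v _ => Finset.sum_congr rfl fun a ha => ?_
  simp only [Finset.mem_filter] at ha
  rw [ha.2]

lemma setIntegral_Iic_comp_sub (g : ℝ → ℝ) (p c : ℝ) :
    ∫ t in Iic p, g (t - c) = ∫ t in Iic (p - c), g t := by
  rw [← integral_indicator measurableSet_Iic, ← integral_indicator measurableSet_Iic,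
    ← integral_sub_right_eq_self ((Iic (p - c)).indicator g) c]
  congr 1
  ext t
  simp [indicator]

lemma setIntegral_Iic_sub_le {g : ℝ → ℝ} {u : ℝ} (hg : Integrable g) (h0 : ∀ t, 0 ≤ g t)
    (hu : ∀ t, g t ≤ u) (p q : ℝ) :
    (∫ t in Iic q, g t) - ∫ t in Iic p, g t ≤ u * max 0 (q - p) := by
  have hu0 : 0 ≤ u := (h0 0).trans (hu 0)
  rcases le_total q p with h | h
  · have : (∫ t in Iic q, g t) ≤ ∫ t in Iic p, g t :=
      setIntegral_mono_set hg.integrableOn (ae_of_all _ h0) (Iic_subset_Iic.2 h).eventuallyLE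
    have : 0 ≤ u * max 0 (q - p) := by positivity
    linarith
  · rw [intervalIntegral.integral_Iic_sub_Iic hg.integrableOn hg.integrableOn,
      max_eq_right (sub_nonneg.2 h)]
    calc ∫ t in p..q, g t ≤ ∫ _ in p..q, u :=
          intervalIntegral.integral_mono_on h hg.intervalIntegrable intervalIntegrable_const
            fun t _ => hu t
      _ = u * (q - p) := by simp [mul_comm]

namespace IsFlowOverTime

variable {N : Network V A} {X Y : Finset V} {θ : ℝ} {f : A → ℝ → ℝ}

lemma integrable (hf : N.IsFlowOverTime X Y θ f) (a : A) : Integrable (f a) := by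
  rw [← integrableOn_iff_integrable_of_support_subset (s := Icc 0 (θ - N.transit a))]
  · refine Measure.integrableOn_of_bounded (M := N.cap a) (by simp)
      (hf.measurable a).aestronglyMeasurable (ae_of_all _ fun t => ?_)
    rw [Real.norm_of_nonneg (hf.nonneg a t)]
    exact hf.le_cap a t
  · intro t ht
    by_contra h
    exact ht (hf.support a t h)

lemma netOut_eq_zero (hf : N.IsFlowOverTime X Y θ f) {v : V} {t : ℝ} (ht : t < 0 ∨ θ < t) :
    N.netOut f v t = 0 := by
  unfold netOut
  rw [Finset.sum_eq_zero, Finset.sum_eq_zero, sub_zero]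
  · intro a _
    apply hf.support
    rintro ⟨h1, h2⟩
    have := N.transit_nonneg a
    rcases ht with h | h <;> linarith
  · intro a _
    apply hf.support
    rintro ⟨h1, h2⟩
    have := N.transit_nonneg a
    rcases ht with h | h <;> linarith

lemma setIntegral_netOut (hf : N.IsFlowOverTime X Y θ f) (v : V) (s : Set ℝ) :
    ∫ t in s, N.netOut f v t = (∑ a with N.src a = v, ∫ t in s, f a t) -
      ∑ a with N.tgt a = v, ∫ t in s, f a (t - N.transit a) := by
  unfold netOut
  have h1 : ∀ a, Integrable (f a) (volume.restrict s) := fun a => (hf.integrable a).integrableOn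
  have h2 : ∀ a, Integrable (fun t => f a (t - N.transit a)) (volume.restrict s) :=
    fun a => ((hf.integrable a).comp_sub_right _).integrableOn
  rw [integral_sub (integrable_finsetSum _ fun a _ => h1 a)
    (integrable_finsetSum _ fun a _ => h2 a),
    integral_finsetSum _ fun a _ => h1 a, integral_finsetSum _ fun a _ => h2 a]

/-- Weak duality: a flow over time has to cross every cut over time. -/
theorem flowValue_le_dualCost [Fintype V] (hf : N.IsFlowOverTime X Y θ f) {p : V → ℝ}
    (hp : IsPotential X Y θ p) : N.flowValue Y f ≤ N.dualCost p := by
  have key : ∀ v, ∫ t in Iic (p v), N.netOut f v t =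
      if v ∈ Y then ∫ t, N.netOut f v t else 0 := by
    intro v
    split_ifs with hY
    · rw [hp.2 v hY]
      refine setIntegral_eq_integral_of_forall_compl_eq_zero fun t ht => ?_
      exact hf.netOut_eq_zero (Or.inr (not_le.1 ht))
    · by_cases hX : v ∈ X
      · rw [hp.1 v hX, integral_Iic_eq_integral_Iio]
        exact setIntegral_eq_zero_of_forall_eq_zero fun t ht => hf.netOut_eq_zero (Or.inl ht)
      · exact integral_eq_zero_of_ae (ae_restrict_of_ae (hf.conservation v hX hY))
  have hval : N.flowValue Y f = - ∑ v, ∫ t in Iic (p v), N.netOut f v t := by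
    simp_rw [key]
    rw [Finset.sum_ite_mem, Finset.univ_inter, ← Finset.sum_neg_distrib]
    unfold flowValue
    exact Finset.sum_congr rfl fun v _ => integral_neg _
  rw [hval]
  simp_rw [hf.setIntegral_netOut]
  rw [Finset.sum_sub_distrib, sum_sum_src N fun v a => ∫ t in Iic (p v), f a t,
    sum_sum_tgt N fun v a => ∫ t in Iic (p v), f a (t - N.transit a), neg_sub,
    ← Finset.sum_sub_distrib]
  refine Finset.sum_le_sum fun a _ => ?_
  rw [setIntegral_Iic_comp_sub]
  refine (setIntegral_Iic_sub_le (hf.integrable a) (hf.nonneg a) (hf.le_cap a) _ _).trans_eq ?_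
  ring_nf

end IsFlowOverTime

/-! ### Temporally repeated flows -/

/-- The net amount of a static flow `x` that leaves the node `v`. -/
def staticNetOut (N : Network V A) (x : A → ℝ) (v : V) : ℝ :=
  (∑ a with N.src a = v, x a) - ∑ a with N.tgt a = v, x a

/-- The value of a static flow `x` that need not be conserved: what arrives at `Y`, minus what is
created at nodes outside `X ∪ Y`. -/
def staticValue [Fintype V] (N : Network V A) (X Y : Finset V) (x : A → ℝ) : ℝ :=
  ∑ v, if v ∈ Y then -N.staticNetOut x v else
    if v ∈ X then 0 else -max 0 (N.staticNetOut x v)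

lemma sum_mul_neg_staticNetOut [Fintype V] (N : Network V A) (x : A → ℝ) (p : V → ℝ) :
    ∑ v, p v * -N.staticNetOut x v = ∑ a, x a * (p (N.tgt a) - p (N.src a)) := by
  unfold staticNetOut
  simp_rw [neg_sub, mul_sub, Finset.mul_sum]
  rw [Finset.sum_sub_distrib, sum_sum_src N fun v a => p v * x a,
    sum_sum_tgt N fun v a => p v * x a, ← Finset.sum_sub_distrib]
  exact Finset.sum_congr rfl fun a _ => by ring

lemma staticNetOut_sub_mul (N : Network V A) (x y : A → ℝ) (e : ℝ) (v : V) :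
    N.staticNetOut (fun a => x a - e * y a) v =
      N.staticNetOut x v - e * N.staticNetOut y v := by
  simp only [staticNetOut, Finset.sum_sub_distrib, mul_sub, Finset.mul_sum]
  ring

lemma netOut_add_mul (N : Network V A) (f g : A → ℝ → ℝ) (e : ℝ) (v : V) (t : ℝ) :
    N.netOut (fun a s => f a s + e * g a s) v t = N.netOut f v t + e * N.netOut g v t := by
  simp only [netOut, Finset.sum_add_distrib, mul_sub, Finset.mul_sum]
  ring

/-- `c` counts the arcs of a walk from `s` to `v`, and a constant unit inflow at `s` during `[0, w]`
can be sent along that walk. -/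
structure IsWalkCount (N : Network V A) (s v : V) (c : A → ℝ) : Prop where
  nonneg : ∀ a, 0 ≤ c a
  netOut : ∀ u, N.staticNetOut c u = (if u = s then 1 else 0) - if u = v then 1 else 0
  block : ∀ w : ℝ, ∃ g : A → ℝ → ℝ, (∀ a, Measurable (g a)) ∧ (∀ a t, 0 ≤ g a t) ∧
    (∀ a t, g a t ≤ c a) ∧
    (∀ a t, t ∉ Icc 0 (∑ a, N.transit a * c a + w - N.transit a) → g a t = 0) ∧
    ∀ u t, N.netOut g u t = (if u = s then (Icc 0 w).indicator (1 : ℝ → ℝ) t else 0) -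
      if u = v then (Icc (∑ a, N.transit a * c a) (∑ a, N.transit a * c a + w)).indicator
        (1 : ℝ → ℝ) t else 0

lemma sum_filter_add_single {B : Type*} [Fintype B] [DecidableEq B] (P : B → Prop)
    [DecidablePred P] (c : B → ℝ) (a : B) (r : ℝ) :
    ∑ b with P b, (c b + if b = a then r else 0) = ∑ b with P b, c b + if P a then r else 0 := by
  rw [Finset.sum_add_distrib, Finset.sum_ite_eq']
  simp

lemma IsWalkCount.nil (N : Network V A) (s : V) : N.IsWalkCount s s 0 where
  nonneg _ := le_rfl
  netOut u := by simp [staticNetOut]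
  block w := ⟨0, fun _ => measurable_const, by simp, by simp, by simp, by simp [Network.netOut]⟩

lemma IsWalkCount.concat [DecidableEq A] {N : Network V A} {s v : V} {c : A → ℝ}
    (h : N.IsWalkCount s v c) (a : A) (ha : N.src a = v) :
    N.IsWalkCount s (N.tgt a) (fun b => c b + if b = a then 1 else 0) where
  nonneg b := by have := h.nonneg b; split_ifs <;> linarith
  netOut u := by
    have := h.netOut u
    unfold staticNetOut at this ⊢
    rw [sum_filter_add_single, sum_filter_add_single, ha]
    simp only [@eq_comm _ v u, @eq_comm _ (N.tgt a) u]
    linarith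
  block w := by
    obtain ⟨g, hm, h0, hc, hs, hn⟩ := h.block w
    set T := ∑ a, N.transit a * c a with hT
    have hT' : ∑ b, N.transit b * (c b + if b = a then 1 else 0) = T + N.transit a := by
      simp [mul_add, Finset.sum_add_distrib, hT]
    have hT0 : 0 ≤ T := Finset.sum_nonneg fun b _ => mul_nonneg (N.transit_nonneg b) (h.nonneg b)
    rw [hT']
    refine ⟨fun b t => g b t + if b = a then (Icc T (T + w)).indicator 1 t else 0, ?_, ?_, ?_, ?_,
      ?_⟩
    · intro b
      refine (hm b).add ?_
      split_ifs
      · exact measurable_one.indicator measurableSet_Icc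
      · exact measurable_const
    · intro b t
      refine add_nonneg (h0 b t) ?_
      split_ifs
      · exact indicator_nonneg (fun _ _ => zero_le_one) _
      · exact le_rfl
    · intro b t
      refine add_le_add (hc b t) ?_
      split_ifs
      · exact indicator_le_self' (fun _ _ => zero_le_one) _
      · exact le_rfl
    · intro b t ht
      beta_reduce
      rw [hs b t, zero_add]
      · split_ifs with hb
        · subst hb
          refine indicator_of_notMem (fun h' => ht ⟨?_, ?_⟩) _
          · exact hT0.trans h'.1
          · linarith [h'.2]
        · rfl
      · exact fun h' => ht ⟨h'.1, by linarith [h'.2, N.transit_nonneg a]⟩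
    · intro u t
      have := hn u t
      unfold Network.netOut at this ⊢
      rw [sum_filter_add_single (N.src · = u)]
      have e : ∀ b, (g b (t - N.transit b) + if b = a then
          (Icc T (T + w)).indicator (1 : ℝ → ℝ) (t - N.transit b) else 0) =
          (g b (t - N.transit b) + if b = a then
          (Icc T (T + w)).indicator (1 : ℝ → ℝ) (t - N.transit a) else 0) := by
        intro b
        split_ifs with hb
        · rw [hb]
        · rfl
      simp_rw [e]
      rw [sum_filter_add_single (N.tgt · = u), ha]
      have e2 : (Icc T (T + w)).indicator (1 : ℝ → ℝ) (t - N.transit a) =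
          (Icc (T + N.transit a) (T + N.transit a + w)).indicator (1 : ℝ → ℝ) t := by
        simp only [indicator, mem_Icc, Pi.one_apply]
        refine if_congr ⟨fun h => ⟨?_, ?_⟩, fun h => ⟨?_, ?_⟩⟩ rfl rfl <;> linarith [h.1, h.2]
      rw [e2]
      simp only [@eq_comm _ v u, @eq_comm _ (N.tgt a) u]
      linarith

/-- A static flow with positive value uses a walk from `X` to `Y`. -/
lemma exists_isWalkCount [Fintype V] (N : Network V A) {X Y : Finset V} {x : A → ℝ}
    (hx : ∀ a, 0 ≤ x a) (hpos : 0 < N.staticValue X Y x) :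
    ∃ s ∈ X, ∃ v ∈ Y, ∃ c, N.IsWalkCount s v c ∧ ∀ a, 0 < c a → 0 < x a := by
  classical
  let R : V → Prop := fun v => ∃ s ∈ X, ∃ c, N.IsWalkCount s v c ∧ ∀ a, 0 < c a → 0 < x a
  by_contra hcon
  have hRY : ∀ v ∈ Y, ¬ R v := fun v hv ⟨s, hs, c, hc⟩ => hcon ⟨s, hs, v, hv, c, hc⟩
  have hRX : ∀ v ∈ X, R v := fun v hv => ⟨v, hv, 0, IsWalkCount.nil N v, by simp⟩
  have hstep : ∀ a, 0 < x a → R (N.src a) → R (N.tgt a) := by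
    rintro a ha ⟨s, hs, c, hc, hcx⟩
    refine ⟨s, hs, _, hc.concat a rfl, fun b hb => ?_⟩
    split_ifs at hb with h
    · rwa [h]
    · exact hcx b (by linarith)
  have h1 := N.sum_mul_neg_staticNetOut x (fun v => if R v then 0 else 1)
  have h2 : ∑ a, x a * ((if R (N.tgt a) then 0 else 1) -
      if R (N.src a) then (0 : ℝ) else 1) ≤ 0 := by
    refine Finset.sum_nonpos fun a _ => ?_
    rcases (hx a).eq_or_lt with h | h
    · simp [← h]
    · refine mul_nonpos_of_nonneg_of_nonpos h.le ?_
      by_cases hR : R (N.src a)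
      · simp [hR, hstep a h hR]
      · simp only [hR, if_false]
        split_ifs <;> norm_num
  have h3 : N.staticValue X Y x ≤ ∑ v, (if R v then 0 else 1) * -N.staticNetOut x v := by
    refine Finset.sum_le_sum fun v _ => ?_
    have hm := le_max_left 0 (N.staticNetOut x v)
    have hm' := le_max_right 0 (N.staticNetOut x v)
    by_cases hY : v ∈ Y
    · simp [hY, hRY v hY]
    · by_cases hX : v ∈ X
      · simp [hY, hX, hRX v hX]
      · simp only [hY, hX, if_false]
        split_ifs <;> linarith
  linarith

lemma isFlowOverTime_zero (N : Network V A) (X Y : Finset V) (θ : ℝ) :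
    N.IsFlowOverTime X Y θ 0 where
  measurable _ := measurable_const
  nonneg _ _ := le_rfl
  le_cap a _ := N.cap_nonneg a
  support _ _ _ := rfl
  conservation v _ _ := by simp [netOut]
  source v _ := by simp [netOut]
  sink v _ := by simp [netOut]

lemma flowValue_zero (N : Network V A) (Y : Finset V) : N.flowValue Y 0 = 0 := by
  simp [flowValue, netOut]

lemma IsFlowOverTime.integrable_netOut {N : Network V A} {X Y : Finset V} {θ : ℝ} {f : A → ℝ → ℝ}
    (hf : N.IsFlowOverTime X Y θ f) (v : V) : Integrable (N.netOut f v) := by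
  unfold netOut
  exact (integrable_finsetSum _ fun a _ => hf.integrable a).sub
    (integrable_finsetSum _ fun a _ => (hf.integrable a).comp_sub_right _)

lemma staticValue_sub_mul [Fintype V] {N : Network V A} {X Y : Finset V} (hXY : Disjoint X Y)
    {s v : V} (hs : s ∈ X) (hv : v ∈ Y) {c : A → ℝ} (hc : N.IsWalkCount s v c) (x : A → ℝ)
    (e : ℝ) :
    N.staticValue X Y (fun a => x a - e * c a) = N.staticValue X Y x - e := by
  have : e = ∑ u, if u = v then e else 0 := by simp
  unfold staticValue
  conv_rhs => rw [this]
  rw [← Finset.sum_sub_distrib]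
  refine Finset.sum_congr rfl fun u _ => ?_
  rw [staticNetOut_sub_mul, hc.netOut]
  have hsY : s ∉ Y := Finset.disjoint_left.1 hXY hs
  by_cases hY : u ∈ Y
  · have : u ≠ s := fun h => hsY (h ▸ hY)
    simp only [hY, if_true, this, if_false]
    split_ifs <;> ring
  · have h1 : u ≠ v := fun h => hY (h ▸ hv)
    by_cases hX : u ∈ X
    · simp [hY, hX, h1]
    · have h2 : u ≠ s := fun h => hX (h ▸ hs)
      simp [hY, hX, h1, h2]

/-- Ford and Fulkerson's temporally repeated flows: as long as the static flow `x` has positive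
value, a walk from `X` to `Y` is split off from `x`, and flow is sent along this walk at a constant
rate for as long as it still arrives by time `θ`. -/
theorem exists_isFlowOverTime_of_static [Fintype V] (N : Network V A) {X Y : Finset V}
    (hXY : Disjoint X Y) {θ : ℝ} (hθ : 0 ≤ θ) (x : A → ℝ) (hx : ∀ a, 0 ≤ x a)
    (hxc : ∀ a, x a ≤ N.cap a) :
    ∃ f, N.IsFlowOverTime X Y θ f ∧ (∀ a t, f a t ≤ x a) ∧
      θ * N.staticValue X Y x - ∑ a, N.transit a * x a ≤ N.flowValue Y f := by
  classical
  induction hn : (Finset.univ.filter fun a => 0 < x a).card using Nat.strong_induction_on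
    generalizing x with
  | _ n ih =>
  by_cases hpos : 0 < N.staticValue X Y x
  swap
  · refine ⟨0, N.isFlowOverTime_zero X Y θ, fun a _ => hx a, ?_⟩
    rw [flowValue_zero]
    have h1 : 0 ≤ ∑ a, N.transit a * x a :=
      Finset.sum_nonneg fun a _ => mul_nonneg (N.transit_nonneg a) (hx a)
    have h2 := mul_nonpos_of_nonneg_of_nonpos hθ (not_lt.1 hpos)
    linarith
  obtain ⟨s, hs, v, hv, c, hc, hcx⟩ := N.exists_isWalkCount hx hpos
  have hsv : s ≠ v := fun h => Finset.disjoint_left.1 hXY hs (h ▸ hv)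
  have hne : (Finset.univ.filter fun a => 0 < c a).Nonempty := by
    by_contra h
    have hc0 : c = 0 := by
      ext a
      have h' := Finset.not_nonempty_iff_eq_empty.1 h
      have : a ∉ (Finset.univ.filter fun a => 0 < c a) := by rw [h']; simp
      simp only [Finset.mem_filter, Finset.mem_univ, true_and, not_lt] at this
      exact le_antisymm this (hc.nonneg a)
    have := hc.netOut s
    simp [hc0, staticNetOut, hsv] at this
  obtain ⟨a₀, ha₀, hmin⟩ := Finset.exists_min_image _ (fun a => x a / c a) hne
  simp only [Finset.mem_filter, Finset.mem_univ, true_and] at ha₀ hmin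
  set e := x a₀ / c a₀ with he
  have he0 : 0 < e := div_pos (hcx _ ha₀) ha₀
  have hx' : ∀ a, 0 ≤ x a - e * c a := by
    intro a
    rcases (hc.nonneg a).eq_or_lt with h | h
    · rw [← h]; simpa using hx a
    · have := (le_div_iff₀ h).1 (hmin a h)
      linarith
  have hle : ∀ a, x a - e * c a ≤ x a := fun a => by
    have := mul_nonneg he0.le (hc.nonneg a)
    linarith
  obtain ⟨f, hf, hfx, hval⟩ := ih _ (by
    rw [← hn]
    refine Finset.card_lt_card ⟨fun a ha => ?_, fun h => ?_⟩
    · simp only [Finset.mem_filter, Finset.mem_univ, true_and] at ha ⊢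
      exact ha.trans_le (hle a)
    · have := h (Finset.mem_filter.2 ⟨Finset.mem_univ a₀, hcx _ ha₀⟩)
      simp only [Finset.mem_filter, Finset.mem_univ, true_and, he] at this
      rw [div_mul_cancel₀ _ ha₀.ne'] at this
      linarith) (fun a => x a - e * c a) hx' (fun a => (hle a).trans (hxc a)) rfl
  rw [staticValue_sub_mul hXY hs hv hc] at hval
  set T := ∑ a, N.transit a * c a with hT
  have hsum : ∑ a, N.transit a * (x a - e * c a) = ∑ a, N.transit a * x a - e * T := by
    rw [hT, Finset.mul_sum, ← Finset.sum_sub_distrib]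
    exact Finset.sum_congr rfl fun a _ => by ring
  rw [hsum] at hval
  rcases lt_or_ge θ T with hlt | hge
  · refine ⟨f, hf, fun a t => (hfx a t).trans (hle a), le_trans ?_ hval⟩
    nlinarith
  obtain ⟨g, gm, g0, gc, gs, gn⟩ := hc.block (θ - T)
  rw [← hT, add_sub_cancel] at gs gn
  have hlex : ∀ a t, f a t + e * g a t ≤ x a := fun a t => by
    have := mul_le_mul_of_nonneg_left (gc a t) he0.le
    linarith [hfx a t]
  have hsY : s ∉ Y := Finset.disjoint_left.1 hXY hs
  have hvX : v ∉ X := fun h => Finset.disjoint_left.1 hXY h hv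
  have i0 : ∀ (I : Set ℝ) t, 0 ≤ I.indicator (1 : ℝ → ℝ) t :=
    fun I t => indicator_nonneg (fun _ _ => zero_le_one) t
  refine ⟨fun a t => f a t + e * g a t, ⟨?_, ?_, ?_, ?_, ?_, ?_, ?_⟩, hlex, ?_⟩
  · exact fun a => (hf.measurable a).add ((gm a).const_mul e)
  · exact fun a t => add_nonneg (hf.nonneg a t) (mul_nonneg he0.le (g0 a t))
  · exact fun a t => (hlex a t).trans (hxc a)
  · intro a t ht
    rw [hf.support a t ht, gs a t ht, mul_zero, add_zero]
  · intro u hX hY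
    filter_upwards [hf.conservation u hX hY] with t ht
    have h1 : u ≠ s := fun h => hX (h ▸ hs)
    have h2 : u ≠ v := fun h => hY (h ▸ hv)
    rw [netOut_add_mul, ht, gn]
    simp [h1, h2]
  · intro u hX
    filter_upwards [hf.source u hX] with t ht
    have h2 : u ≠ v := fun h => hvX (h ▸ hX)
    rw [netOut_add_mul, gn]
    simp only [h2, if_false, sub_zero]
    refine add_nonneg ht (mul_nonneg he0.le ?_)
    split_ifs
    · exact i0 _ t
    · exact le_rfl
  · intro u hY
    filter_upwards [hf.sink u hY] with t ht
    have h2 : u ≠ s := fun h => hsY (h ▸ hY)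
    rw [netOut_add_mul, gn]
    simp only [h2, if_false, zero_sub]
    refine add_nonpos ht (mul_nonpos_of_nonneg_of_nonpos he0.le ?_)
    split_ifs
    · exact neg_nonpos.2 (i0 _ t)
    · simp
  · have hv' : N.flowValue Y (fun a t => f a t + e * g a t) =
        N.flowValue Y f + e * (θ - T) := by
      have : e * (θ - T) = ∑ u ∈ Y, if u = v then e * (θ - T) else 0 := by simp [hv]
      unfold flowValue
      rw [this, ← Finset.sum_add_distrib]
      refine Finset.sum_congr rfl fun u hu => ?_
      have h2 : u ≠ s := fun h => hsY (h ▸ hu)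
      simp_rw [netOut_add_mul, gn]
      simp only [h2, if_false, zero_sub]
      split_ifs with huv
      · simp_rw [neg_add, mul_neg, neg_neg]
        have i1 : Integrable fun t => -N.netOut f u t := (hf.integrable_netOut u).neg
        have i2 : Integrable ((Icc T θ).indicator (1 : ℝ → ℝ)) :=
          (integrable_indicator_iff measurableSet_Icc).2
            (integrableOn_const (μ := volume) (C := (1 : ℝ)) (by simp))
        rw [integral_add i1 (i2.const_mul e), integral_const_mul,
          integral_indicator_one measurableSet_Icc]
        simp [measureReal_def, hge]
      · simp
    rw [hv']
    linarith

/-! ### Strong duality -/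

/-- Strong duality: the pairing `∑ x a * (p (tgt a) - p (src a) - τ a)` has a saddle point by Sion's
minimax theorem. Maximizing it over the static flows `x` gives the capacity of the cut over time
`p`, minimizing it over the potentials `p` gives the value of a temporally repeated flow. -/
theorem exists_dualCost_le_flowValue [Fintype V] (N : Network V A) {X Y : Finset V}
    (hXY : Disjoint X Y) {θ : ℝ} (hθ : 0 ≤ θ) :
    ∃ p, IsPotential X Y θ p ∧ (∀ v, p v ∈ Icc 0 θ) ∧
      ∃ f, N.IsFlowOverTime X Y θ f ∧ N.dualCost p ≤ N.flowValue Y f := by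
  classical
  let I : V → Set ℝ := fun v => if v ∈ Y then {θ} else if v ∈ X then {0} else Icc 0 θ
  let L : (V → ℝ) → (A → ℝ) → ℝ := fun p x =>
    ∑ a, x a * (p (N.tgt a) - p (N.src a) - N.transit a)
  have hIc : ∀ v, Convex ℝ (I v) := fun v => by
    simp only [I]
    split_ifs
    exacts [convex_singleton _, convex_singleton _, convex_Icc _ _]
  have hIk : ∀ v, IsCompact (I v) := fun v => by
    simp only [I]
    split_ifs
    exacts [isCompact_singleton, isCompact_singleton, isCompact_Icc]
  have hIn : ∀ v, (I v).Nonempty := fun v => by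
    simp only [I]
    split_ifs
    exacts [singleton_nonempty _, singleton_nonempty _, nonempty_Icc.2 hθ]
  have hPc : Convex ℝ (univ.pi I) := convex_pi fun v _ => hIc v
  have hBc : Convex ℝ (univ.pi fun a => Icc 0 (N.cap a)) := convex_pi fun a _ => convex_Icc _ _
  have hL1 : ∀ x, Continuous fun p => L p x := fun x => by fun_prop
  have hL2 : ∀ p, Continuous fun x => L p x := fun p => by fun_prop
  obtain ⟨p, hp, x, hx, hsad⟩ := Sion.exists_isSaddlePointOn (f := L)
    (univ_pi_nonempty_iff.2 hIn) hPc (isCompact_univ_pi hIk)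
    (fun x _ => (hL1 x).lowerSemicontinuous.lowerSemicontinuousOn _)
    (fun x _ => by
      refine ConvexOn.quasiconvexOn ⟨hPc, fun p _ q _ s t _ _ hst => le_of_eq ?_⟩
      simp only [L, Pi.add_apply, Pi.smul_apply, smul_eq_mul, Finset.mul_sum]
      rw [← Finset.sum_add_distrib]
      refine Finset.sum_congr rfl fun a _ => ?_
      linear_combination (x a * N.transit a) * hst) hBc
    (univ_pi_nonempty_iff.2 fun a => nonempty_Icc.2 (N.cap_nonneg a))
    (isCompact_univ_pi fun a => isCompact_Icc)
    (fun p _ => (hL2 p).upperSemicontinuous.upperSemicontinuousOn _)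
    (fun p _ => by
      refine ConcaveOn.quasiconcaveOn ⟨hBc, fun x _ y _ s t _ _ _ => le_of_eq ?_⟩
      simp only [L, Pi.add_apply, Pi.smul_apply, smul_eq_mul, Finset.mul_sum]
      rw [← Finset.sum_add_distrib]
      exact Finset.sum_congr rfl fun a _ => by ring)
  have hp' : ∀ v, p v ∈ I v := fun v => hp v (mem_univ v)
  have hx0 : ∀ a, 0 ≤ x a := fun a => (hx a (mem_univ a)).1
  obtain ⟨f, hf, -, hfv⟩ := N.exists_isFlowOverTime_of_static hXY hθ x hx0
    fun a => (hx a (mem_univ a)).2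
  refine ⟨p, ⟨fun v hv => ?_, fun v hv => ?_⟩, fun v => ?_, f, hf, le_trans ?_ hfv⟩
  · have := hp' v
    simpa [I, hv, Finset.disjoint_left.1 hXY hv] using this
  · have := hp' v
    simpa [I, hv] using this
  · have := hp' v
    simp only [I] at this
    split_ifs at this
    · rw [mem_singleton_iff.1 this]; exact ⟨hθ, le_rfl⟩
    · rw [mem_singleton_iff.1 this]; exact ⟨le_rfl, hθ⟩
    · exact this
  -- The best response to `p` saturates the arcs that cross the cut, the best response to `x` is
  -- `θ` exactly on `Y` and at the nodes outside `X` that create flow.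
  have h1 := hsad (fun v => if v ∈ Y then θ else if v ∈ X then 0 else
      if 0 < N.staticNetOut x v then θ else 0) (fun v _ => by
        simp only [I]
        split_ifs <;> simp [hθ])
    (fun a => if 0 < p (N.tgt a) - p (N.src a) - N.transit a then N.cap a else 0) (fun a _ => by
        have := N.cap_nonneg a
        beta_reduce
        split_ifs <;> simp [this])
  have h2 : L p (fun a => if 0 < p (N.tgt a) - p (N.src a) - N.transit a then N.cap a else 0) =
      N.dualCost p := by
    refine Finset.sum_congr rfl fun a _ => ?_
    beta_reduce
    split_ifs with h
    · rw [max_eq_right h.le]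
    · rw [max_eq_left (not_lt.1 h)]; ring
  rw [h2] at h1
  refine h1.trans_eq ?_
  simp only [L, mul_sub]
  rw [Finset.sum_sub_distrib]
  simp only [← mul_sub]
  rw [← N.sum_mul_neg_staticNetOut x fun v => if v ∈ Y then θ else if v ∈ X then 0 else
      if 0 < N.staticNetOut x v then θ else 0]
  congr 1
  · rw [staticValue, Finset.mul_sum]
    refine Finset.sum_congr rfl fun v _ => ?_
    split_ifs with _ _ h
    · rfl
    · ring
    · rw [max_eq_right h.le]
    · rw [max_eq_left (not_lt.1 h)]; ring
  · exact Finset.sum_congr rfl fun a _ => mul_comm _ _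

lemma disjoint_sources_sinks {V A : Type*} [DecidableEq V] (N : Network V A) (S : Finset V) :
    Disjoint (N.sources ∩ S) (N.sinks \ S) :=
  N.disjoint.mono Finset.inter_subset_left Finset.sdiff_subset

lemma IsFlowOverTime.mono {N : Network V A} {X Y : Finset V} {θ η : ℝ} {f : A → ℝ → ℝ}
    (hf : N.IsFlowOverTime X Y θ f) (h : θ ≤ η) : N.IsFlowOverTime X Y η f :=
  { hf with
    support := fun a t ht => hf.support a t fun h' => ht ⟨h'.1, by linarith [h'.2]⟩ }

section

variable [Fintype V] (N : Network V A) {θ : ℝ} {S : Finset V}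

lemma maxFlow_le_dualCost {p : V → ℝ}
    (hp : IsPotential (N.sources ∩ S) (N.sinks \ S) θ p) : N.maxFlow θ S ≤ N.dualCost p := by
  refine csSup_le ⟨_, 0, N.isFlowOverTime_zero _ _ θ, rfl⟩ ?_
  rintro _ ⟨f, hf, rfl⟩
  exact hf.flowValue_le_dualCost hp

lemma flowValue_le_maxFlow (hθ : 0 ≤ θ) {f : A → ℝ → ℝ}
    (hf : N.IsFlowOverTime (N.sources ∩ S) (N.sinks \ S) θ f) :
    N.flowValue (N.sinks \ S) f ≤ N.maxFlow θ S := by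
  obtain ⟨p, hp, -⟩ := N.exists_dualCost_le_flowValue (N.disjoint_sources_sinks S) hθ
  refine le_csSup ⟨N.dualCost p, ?_⟩ ⟨f, hf, rfl⟩
  rintro _ ⟨g, hg, rfl⟩
  exact hg.flowValue_le_dualCost hp

/-- The maximum flow over time equals the capacity of a cut over time. -/
lemma exists_maxFlow_eq_dualCost (hθ : 0 ≤ θ) :
    ∃ p, IsPotential (N.sources ∩ S) (N.sinks \ S) θ p ∧ (∀ v, p v ∈ Icc 0 θ) ∧
      N.maxFlow θ S = N.dualCost p := by
  obtain ⟨p, hp, h0, f, hf, hle⟩ :=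
    N.exists_dualCost_le_flowValue (N.disjoint_sources_sinks S) hθ
  exact ⟨p, hp, h0, (N.maxFlow_le_dualCost hp).antisymm (hle.trans (N.flowValue_le_maxFlow hθ hf))⟩

lemma monotoneOn_maxFlow (S : Finset V) : MonotoneOn (fun t => N.maxFlow t S) (Ici 0) := by
  intro θ _ η hη h
  refine csSup_le ⟨_, 0, N.isFlowOverTime_zero _ _ θ, rfl⟩ ?_
  rintro _ ⟨f, hf, rfl⟩
  exact N.flowValue_le_maxFlow hη (hf.mono h)

lemma convexOn_maxFlow (S : Finset V) : ConvexOn ℝ (Ici 0) fun t => N.maxFlow t S := by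
  refine ⟨convex_Ici 0, fun θ hθ η hη s t hs ht hst => ?_⟩
  obtain ⟨p, hp, -, hpe⟩ := N.exists_maxFlow_eq_dualCost (S := S) hθ
  obtain ⟨q, hq, -, hqe⟩ := N.exists_maxFlow_eq_dualCost (S := S) hη
  have hpq : IsPotential (N.sources ∩ S) (N.sinks \ S) (s • θ + t • η)
      (fun v => s * p v + t * q v) :=
    ⟨fun v hv => by simp [hp.1 v hv, hq.1 v hv], fun v hv => by simp [hp.2 v hv, hq.2 v hv]⟩
  refine (N.maxFlow_le_dualCost hpq).trans ?_
  beta_reduce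
  rw [hpe, hqe]
  simp only [dualCost, smul_eq_mul, Finset.mul_sum]
  rw [← Finset.sum_add_distrib]
  refine Finset.sum_le_sum fun a _ => ?_
  rw [mul_left_comm s, mul_left_comm t, ← mul_add]
  refine mul_le_mul_of_nonneg_left (max_le ?_ ?_) (N.cap_nonneg a)
  · positivity
  · have h1 := mul_le_mul_of_nonneg_left
      (le_max_right 0 (p (N.tgt a) - p (N.src a) - N.transit a)) hs
    have h2 := mul_le_mul_of_nonneg_left
      (le_max_right 0 (q (N.tgt a) - q (N.src a) - N.transit a)) ht
    linear_combination h1 + h2 + N.transit a * hst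

lemma max_zero_min_sub_add_le (a b c d e : ℝ) :
    max 0 (min a b - min c d - e) + max 0 (max a b - max c d - e) ≤
      max 0 (a - c - e) + max 0 (b - d - e) := by
  rcases le_total a b with h | h <;> rcases le_total c d with h' | h' <;>
    simp only [h, h', min_eq_left, min_eq_right, max_eq_left, max_eq_right] <;>
    rcases max_cases 0 (a - c - e) with h1 | h1 <;> rcases max_cases 0 (b - d - e) with h2 | h2 <;>
    rcases max_cases 0 (a - d - e) with h3 | h3 <;> rcases max_cases 0 (b - c - e) with h4 | h4 <;>
    linarith

lemma maxFlow_submodular (hθ : 0 ≤ θ) (S T : Finset V) :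
    N.maxFlow θ (S ∪ T) + N.maxFlow θ (S ∩ T) ≤ N.maxFlow θ S + N.maxFlow θ T := by
  obtain ⟨p, hp, hp0, hpe⟩ := N.exists_maxFlow_eq_dualCost (S := S) hθ
  obtain ⟨q, hq, hq0, hqe⟩ := N.exists_maxFlow_eq_dualCost (S := T) hθ
  have h1 : IsPotential (N.sources ∩ (S ∪ T)) (N.sinks \ (S ∪ T)) θ
      (fun v => min (p v) (q v)) := by
    refine ⟨fun v hv => ?_, fun v hv => ?_⟩ <;> beta_reduce
    · simp only [Finset.mem_inter, Finset.mem_union] at hv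
      rcases hv.2 with h | h
      · rw [hp.1 v (Finset.mem_inter.2 ⟨hv.1, h⟩), min_eq_left (hq0 v).1]
      · rw [hq.1 v (Finset.mem_inter.2 ⟨hv.1, h⟩), min_eq_right (hp0 v).1]
    · simp only [Finset.mem_sdiff, Finset.mem_union, not_or] at hv
      rw [hp.2 v (Finset.mem_sdiff.2 ⟨hv.1, hv.2.1⟩), hq.2 v (Finset.mem_sdiff.2 ⟨hv.1, hv.2.2⟩),
        min_self]
  have h2 : IsPotential (N.sources ∩ (S ∩ T)) (N.sinks \ (S ∩ T)) θ
      (fun v => max (p v) (q v)) := by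
    refine ⟨fun v hv => ?_, fun v hv => ?_⟩ <;> beta_reduce
    · simp only [Finset.mem_inter] at hv
      rw [hp.1 v (Finset.mem_inter.2 ⟨hv.1, hv.2.1⟩), hq.1 v (Finset.mem_inter.2 ⟨hv.1, hv.2.2⟩),
        max_self]
    · simp only [Finset.mem_sdiff, Finset.mem_inter, not_and_or] at hv
      rcases hv.2 with h | h
      · rw [hp.2 v (Finset.mem_sdiff.2 ⟨hv.1, h⟩), max_eq_left (hq0 v).2]
      · rw [hq.2 v (Finset.mem_sdiff.2 ⟨hv.1, h⟩), max_eq_right (hp0 v).2]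
  refine (add_le_add (N.maxFlow_le_dualCost h1) (N.maxFlow_le_dualCost h2)).trans ?_
  rw [hpe, hqe]
  unfold dualCost
  rw [← Finset.sum_add_distrib, ← Finset.sum_add_distrib]
  refine Finset.sum_le_sum fun a _ => ?_
  rw [← mul_add, ← mul_add]
  exact mul_le_mul_of_nonneg_left (max_zero_min_sub_add_le _ _ _ _ _) (N.cap_nonneg a)

end

/-! ### Breakpoints -/

lemma eventually_max_zero_affine {α β t : ℝ} (h : β = 0 ∨ α + β * t ≠ 0) :
    ∃ p q : ℝ, ∀ᶠ s in nhds t, max 0 (α + β * s) = p * s + q := by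
  have hc : Continuous fun s : ℝ => α + β * s := by fun_prop
  rcases h with rfl | h
  · exact ⟨0, max 0 α, by simp⟩
  rcases h.lt_or_gt with h | h
  · refine ⟨0, 0, (hc.continuousAt.eventually_lt continuousAt_const h).mono fun s hs => ?_⟩
    rw [max_eq_left hs.le]; ring
  · refine ⟨β, α, (continuousAt_const.eventually_lt hc.continuousAt h).mono fun s hs => ?_⟩
    rw [max_eq_right hs.le]; ring

/-- A convex function that lies below an affine function and touches it at an interior point agrees
with it near that point. -/
lemma _root_.ConvexOn.eventually_eq_affine {f : ℝ → ℝ} (hf : ConvexOn ℝ (Ici 0) f) {t p q : ℝ}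
    (ht : 0 < t) (hle : ∀ᶠ s in nhds t, f s ≤ p * s + q) (heq : f t = p * t + q) :
    ∀ᶠ s in nhds t, f s = p * s + q := by
  have hrefl : Filter.Tendsto (fun s => 2 * t - s) (nhds t) (nhds t) := by
    have : Continuous fun s : ℝ => 2 * t - s := by fun_prop
    simpa [two_mul] using this.tendsto t
  have hpos : ∀ᶠ s in nhds t, 0 < s := lt_mem_nhds ht
  filter_upwards [hle, hrefl.eventually hle, hpos, hrefl.eventually hpos] with s h1 h2 h3 h4
  have := hf.2 h3.le h4.le (by norm_num : (0 : ℝ) ≤ 1 / 2) (by norm_num : (0 : ℝ) ≤ 1 / 2)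
    (by norm_num)
  simp only [smul_eq_mul] at this
  rw [show 1 / 2 * s + 1 / 2 * (2 * t - s) = t by ring, heq] at this
  linarith

/-- The graph of the tight arcs of the potential `p`: those with `p (tgt a) - p (src a) = τ a`. -/
def tightGraph (N : Network V A) (p : V → ℝ) : SimpleGraph V :=
  SimpleGraph.fromRel fun v w => ∃ a, N.src a = v ∧ N.tgt a = w ∧ p w - p v = N.transit a

lemma exists_eq_add_sum_of_walk [DecidableEq A] (N : Network V A) {p : V → ℝ} {r v : V}
    (P : (N.tightGraph p).Walk r v) :
    ∃ y : A → ℤ, (∀ a, |y a| ≤ P.edges.count s(N.src a, N.tgt a)) ∧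
      p v = p r + ∑ a, y a * N.transit a := by
  induction P with
  | nil => exact ⟨0, by simp, by simp⟩
  | @cons u w v h P ih =>
    obtain ⟨y, hy, hyv⟩ := ih
    obtain ⟨a, σ, hσ, he, hw⟩ : ∃ (a : A) (σ : ℤ), |σ| ≤ 1 ∧ s(N.src a, N.tgt a) = s(u, w) ∧
        p w = p u + σ * N.transit a := by
      rw [tightGraph, SimpleGraph.fromRel_adj] at h
      rcases h.2 with ⟨a, h1, h2, h3⟩ | ⟨a, h1, h2, h3⟩
      · exact ⟨a, 1, by simp, by rw [h1, h2], by push_cast; linarith⟩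
      · exact ⟨a, -1, by simp, by rw [h1, h2, Sym2.eq_swap], by push_cast; linarith⟩
    refine ⟨fun b => y b + if b = a then σ else 0, fun b => ?_, ?_⟩
    · rw [SimpleGraph.Walk.edges_cons, List.count_cons]
      push_cast
      refine (abs_add_le _ _).trans (add_le_add (hy b) ?_)
      by_cases hb : b = a
      · subst hb
        simpa [he] using hσ
      · simp only [hb, if_false, abs_zero]
        split_ifs <;> simp
    · rw [hyv, hw]
      push_cast
      simp only [add_mul, Finset.sum_add_distrib, ite_mul, zero_mul, Finset.sum_ite_eq',
        Finset.mem_univ, if_true]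
      ring

lemma eventually_max_zero_add {D : ℝ} (hD : D ≠ 0) :
    ∀ᶠ δ in nhds (0 : ℝ), max 0 (D - δ) + max 0 (D + δ) = 2 * max 0 D := by
  have hc1 : Continuous fun δ : ℝ => D - δ := by fun_prop
  have hc2 : Continuous fun δ : ℝ => D + δ := by fun_prop
  rcases hD.lt_or_gt with h | h
  · filter_upwards [hc1.continuousAt.eventually_lt continuousAt_const (by simpa using h),
      hc2.continuousAt.eventually_lt continuousAt_const (by simpa using h)] with δ h1 h2
    rw [max_eq_left h1.le, max_eq_left h2.le, max_eq_left h.le]; ring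
  · filter_upwards [continuousAt_const.eventually_lt hc1.continuousAt (by simpa using h),
      continuousAt_const.eventually_lt hc2.continuousAt (by simpa using h)] with δ h1 h2
    rw [max_eq_right h1.le, max_eq_right h2.le, max_eq_right h.le]; ring

/-- Some minimum cut over time has the property that every node is joined by tight arcs to a node
whose potential is `0` or `θ`: take an optimal potential with the least sum. If a component of the
tight graph contained no such node, it could be moved up and down a little; the capacity is linear
in this shift, hence constant, and moving down decreases the sum. -/
lemma exists_tight_potential [Fintype V] (N : Network V A) (S : Finset V) {θ : ℝ} (hθ : 0 ≤ θ) :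
    ∃ p, IsPotential (N.sources ∩ S) (N.sinks \ S) θ p ∧ N.maxFlow θ S = N.dualCost p ∧
      ∀ v, ∃ r, (N.tightGraph p).Reachable r v ∧ (p r = 0 ∨ p r = θ) := by
  classical
  set X := N.sources ∩ S
  set Y := N.sinks \ S
  let O : Set (V → ℝ) := {p | (∀ v, p v ∈ Icc 0 θ) ∧ ((∀ v ∈ X, p v = 0) ∧ ∀ v ∈ Y, p v = θ) ∧
    N.maxFlow θ S = N.dualCost p}
  have hOc : IsCompact O := by
    have hcost : Continuous N.dualCost := by unfold dualCost; fun_prop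
    have hcl : IsClosed (((⋂ v ∈ X, {p : V → ℝ | p v = 0}) ∩ ⋂ v ∈ Y, {p : V → ℝ | p v = θ}) ∩
        {p | N.maxFlow θ S = N.dualCost p}) :=
      ((isClosed_biInter fun v _ => isClosed_eq (continuous_apply v) continuous_const).inter
        (isClosed_biInter fun v _ => isClosed_eq (continuous_apply v) continuous_const)).inter
        (isClosed_eq continuous_const hcost)
    convert (isCompact_univ_pi fun _ : V => isCompact_Icc (a := (0 : ℝ)) (b := θ)).inter_right hcl
      using 1
    ext p
    simp [O, Pi.le_def, forall_and]
  have hOn : O.Nonempty := by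
    obtain ⟨p, hp, h0, he⟩ := N.exists_maxFlow_eq_dualCost (S := S) hθ
    exact ⟨p, h0, hp, he⟩
  have hsum : Continuous fun p : V → ℝ => ∑ v, p v := by fun_prop
  obtain ⟨p, ⟨hp0, hp, hpe⟩, hmin⟩ := hOc.exists_isMinOn hOn hsum.continuousOn
  refine ⟨p, hp, hpe, fun v => ?_⟩
  by_contra! hcon
  let C : V → Prop := fun r => (N.tightGraph p).Reachable r v
  have hCv : C v := SimpleGraph.Reachable.refl v
  have hC0 : ∀ r, C r → 0 < p r ∧ p r < θ := fun r hr =>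
    ⟨(hp0 r).1.lt_of_ne (hcon r hr).1.symm, (hp0 r).2.lt_of_ne (hcon r hr).2⟩
  have hCadj : ∀ a, p (N.tgt a) - p (N.src a) = N.transit a → (C (N.tgt a) ↔ C (N.src a)) := by
    intro a ha
    by_cases hne : N.src a = N.tgt a
    · rw [hne]
    have hadj : (N.tightGraph p).Adj (N.src a) (N.tgt a) := by
      rw [tightGraph, SimpleGraph.fromRel_adj]
      exact ⟨hne, Or.inl ⟨a, rfl, rfl, ha⟩⟩
    exact ⟨fun h => hadj.reachable.trans h, fun h => hadj.symm.reachable.trans h⟩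
  let q : ℝ → V → ℝ := fun δ r => p r - if C r then δ else 0
  have hev1 : ∀ᶠ δ in nhds (0 : ℝ), ∀ r, C r → |δ| < p r ∧ |δ| < θ - p r := by
    refine Filter.eventually_all.2 fun r => ?_
    by_cases hr : C r
    · have hc : Continuous fun δ : ℝ => |δ| := continuous_abs
      filter_upwards [hc.continuousAt.eventually_lt continuousAt_const
        (by simpa using (hC0 r hr).1 : |(0 : ℝ)| < p r), hc.continuousAt.eventually_lt
        continuousAt_const (by simpa using (hC0 r hr).2 : |(0 : ℝ)| < θ - p r)] with δ h1 h2
      exact fun _ => ⟨h1, h2⟩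
    · exact Filter.Eventually.of_forall fun δ h => absurd h hr
  have hev2 : ∀ᶠ δ in nhds (0 : ℝ), ∀ a,
      max 0 (q δ (N.tgt a) - q δ (N.src a) - N.transit a) +
        max 0 (q (-δ) (N.tgt a) - q (-δ) (N.src a) - N.transit a) =
      2 * max 0 (p (N.tgt a) - p (N.src a) - N.transit a) := by
    refine Filter.eventually_all.2 fun a => ?_
    by_cases hD : p (N.tgt a) - p (N.src a) - N.transit a = 0
    · refine Filter.Eventually.of_forall fun δ => ?_
      have := hCadj a (sub_eq_zero.1 hD)
      simp only [q, this]
      rw [sub_sub_sub_cancel_right, sub_sub_sub_cancel_right, ← two_mul]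
    · filter_upwards [eventually_max_zero_add hD] with δ hδ
      simp only [q]
      by_cases h1 : C (N.tgt a) <;> by_cases h2 : C (N.src a) <;>
        simp only [h1, h2, if_true, if_false, sub_zero]
      · rw [sub_sub_sub_cancel_right, sub_sub_sub_cancel_right, ← two_mul]
      · rw [← hδ]; ring_nf
      · rw [← hδ, add_comm]; ring_nf
      · rw [← two_mul]
  obtain ⟨δ, ⟨h1, h2⟩, hδ⟩ :=
    (((hev1.and hev2).filter_mono nhdsWithin_le_nhds).and
      (self_mem_nhdsWithin : Ioi (0 : ℝ) ∈ nhdsWithin 0 (Ioi 0))).exists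
  have hq : ∀ ε, |ε| = |δ| → (∀ r, q ε r ∈ Icc 0 θ) ∧ IsPotential X Y θ (q ε) := by
    intro ε hε
    refine ⟨fun r => ?_, fun r hr => ?_, fun r hr => ?_⟩
    · simp only [q]
      split_ifs with hr
      · have := h1 r hr
        rw [← hε] at this
        constructor <;> linarith [le_abs_self ε, neg_abs_le ε]
      · simpa using hp0 r
    · have : ¬ C r := fun h => (hC0 r h).1.ne' (hp.1 r hr)
      simp [q, this, hp.1 r hr]
    · have : ¬ C r := fun h => (hC0 r h).2.ne (hp.2 r hr)
      simp [q, this, hp.2 r hr]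
  have hcost : N.dualCost (q δ) + N.dualCost (q (-δ)) = 2 * N.dualCost p := by
    unfold dualCost
    rw [← Finset.sum_add_distrib, Finset.mul_sum]
    refine Finset.sum_congr rfl fun a _ => ?_
    rw [← mul_add, h2 a]; ring
  have hle1 := N.maxFlow_le_dualCost (hq δ rfl).2
  have hle2 := N.maxFlow_le_dualCost (hq (-δ) (abs_neg δ)).2
  have hlt : ∑ r, q δ r < ∑ r, p r := by
    refine Finset.sum_lt_sum (fun r _ => ?_) ⟨v, Finset.mem_univ v, ?_⟩
    · simp only [q]
      have : (0 : ℝ) < δ := hδ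
      split_ifs <;> linarith
    · simp only [q, hCv, if_true]
      have : (0 : ℝ) < δ := hδ
      linarith
  exact absurd (hmin ⟨(hq δ rfl).1, (hq δ rfl).2, by linarith⟩) (not_le.2 hlt)

/-- Some minimum cut over time consists of times `∑ y a * τ a + e * θ` with coefficients
`y a ∈ {-1, 0, 1}` and `e ∈ {0, 1}`. -/
lemma exists_integral_potential [Fintype V] (N : Network V A) (S : Finset V) {θ : ℝ} (hθ : 0 ≤ θ) :
    ∃ (y : V → A → ℤ) (e : V → ℤ), (∀ v a, |y v a| ≤ 1) ∧ (∀ v, e v = 0 ∨ e v = 1) ∧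
      (∀ s, IsPotential (N.sources ∩ S) (N.sinks \ S) s
        fun v => ∑ a, y v a * N.transit a + e v * s) ∧
      N.maxFlow θ S = N.dualCost fun v => ∑ a, y v a * N.transit a + e v * θ := by
  classical
  obtain ⟨p, hp, hpe, hr⟩ := N.exists_tight_potential S hθ
  have key : ∀ v, ∃ (y : A → ℤ) (e : ℤ), (∀ a, |y a| ≤ 1) ∧ (e = 0 ∨ e = 1) ∧
      (v ∈ N.sources ∩ S → y = 0 ∧ e = 0) ∧ (v ∈ N.sinks \ S → y = 0 ∧ e = 1) ∧
      p v = ∑ a, y a * N.transit a + e * θ := by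
    intro v
    have hd := Finset.disjoint_left.1 (N.disjoint_sources_sinks S)
    by_cases hX : v ∈ N.sources ∩ S
    · exact ⟨0, 0, by simp, by simp, by simp, fun h => absurd h (hd hX), by simp [hp.1 v hX]⟩
    by_cases hY : v ∈ N.sinks \ S
    · exact ⟨0, 1, by simp, by simp, fun h => absurd h hX, by simp, by simp [hp.2 v hY]⟩
    obtain ⟨r, hrv, hr0⟩ := hr v
    obtain ⟨P, hP⟩ := hrv.exists_isPath
    obtain ⟨y, hy, hyv⟩ := N.exists_eq_add_sum_of_walk P
    refine ⟨y, if p r = 0 then 0 else 1, fun a => (hy a).trans ?_, by split_ifs <;> simp,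
      fun h => absurd h hX, fun h => absurd h hY, ?_⟩
    · exact_mod_cast List.nodup_iff_count_le_one.1 hP.isTrail.edges_nodup _
    · rw [hyv]
      split_ifs with h
      · rw [h]; simp
      · rw [hr0.resolve_left h]; push_cast; ring
  choose y e hy he hX hY hv using key
  refine ⟨y, e, hy, he, fun s => ⟨fun v h => ?_, fun v h => ?_⟩, ?_⟩
  · simp [(hX v h).1, (hX v h).2]
  · simp [(hY v h).1, (hY v h).2]
  · rw [hpe]
    congr 1
    ext v
    exact hv v

/-- Unless `t` is a combination of the transit times with small integer coefficients, a minimum cut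
over time at `t` moves linearly with `t` without any of its terms changing sign. Its capacity is
then an affine function above the convex function `o` that touches it at `t`. -/
lemma eventually_maxFlow_affine [Fintype V] (N : Network V A) (S : Finset V) {t : ℝ} (ht : 0 < t)
    (h : ∀ y : A → ℤ, (∀ a, |y a| ≤ 3) → t ≠ ∑ a, y a * N.transit a) :
    ∃ p q : ℝ, ∀ᶠ s in nhds t, N.maxFlow s S = p * s + q := by
  classical
  obtain ⟨y, e, hy, he, hpot, hopt⟩ := N.exists_integral_potential S ht.le
  let α : A → ℝ := fun a =>
    ∑ c, y (N.tgt a) c * N.transit c - ∑ c, y (N.src a) c * N.transit c - N.transit a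
  have haff : ∀ a, ∃ p q : ℝ, ∀ᶠ s in nhds t,
      max 0 (α a + (e (N.tgt a) - e (N.src a) : ℤ) * s) = p * s + q := by
    intro a
    apply eventually_max_zero_affine
    by_contra! hcon
    obtain ⟨hβ, h0⟩ := hcon
    have hβ' : e (N.tgt a) - e (N.src a) ≠ 0 := by exact_mod_cast hβ
    have hα : ∀ σ : ℤ, |σ| = 1 → t ≠ σ * α a := by
      intro σ hσ ht'
      refine h (fun c => σ * (y (N.tgt a) c - y (N.src a) c - if c = a then 1 else 0))
        (fun c => ?_) (ht'.trans ?_)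
      · rw [abs_mul, hσ, one_mul]
        have h1 := abs_le.1 (hy (N.tgt a) c)
        have h2 := abs_le.1 (hy (N.src a) c)
        rw [abs_le]
        split_ifs <;> constructor <;> linarith [h1.1, h1.2, h2.1, h2.2]
      · push_cast
        simp only [mul_assoc, ← Finset.mul_sum, sub_mul, Finset.sum_sub_distrib, ite_mul, one_mul,
          zero_mul, Finset.sum_ite_eq', Finset.mem_univ, if_true, α]
    rcases he (N.tgt a) with h1 | h1 <;> rcases he (N.src a) with h2 | h2 <;>
      simp only [h1, h2] at h0 hβ'
    · exact hβ' rfl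
    · exact hα 1 (by simp) (by push_cast at h0 ⊢; linarith)
    · exact hα (-1) (by simp) (by push_cast at h0 ⊢; linarith)
    · exact hβ' rfl
  choose P Q hPQ using haff
  have hcost : ∀ᶠ s in nhds t, N.dualCost (fun v => ∑ a, y v a * N.transit a + e v * s) =
      (∑ a, N.cap a * P a) * s + ∑ a, N.cap a * Q a := by
    filter_upwards [Filter.eventually_all.2 hPQ] with s hs
    unfold dualCost
    rw [Finset.sum_mul, ← Finset.sum_add_distrib]
    refine Finset.sum_congr rfl fun a _ => ?_
    rw [mul_assoc, ← mul_add, ← hs a]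
    congr 2
    simp only [α]
    push_cast
    ring
  refine ⟨_, _, (N.convexOn_maxFlow S).eventually_eq_affine ht
    (hcost.mono fun s hs => ?_) (hopt.trans hcost.self_of_nhds)⟩
  rw [← hs]
  exact N.maxFlow_le_dualCost (hpot s)

lemma IsBreakpoint.exists_eq_sum [Fintype V] {N : Network V A} {b : V → ℝ} {T : Finset V} {t : ℝ}
    (h : IsBreakpoint (fun s => N.slack b s T) t) :
    ∃ y : A → ℤ, (∀ a, |y a| ≤ 3) ∧ t = ∑ a, y a * N.transit a := by
  by_contra! hcon
  obtain ⟨p, q, hpq⟩ := N.eventually_maxFlow_affine T h.1 hcon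
  refine h.2 ⟨p, q - ∑ v ∈ T, b v, hpq.mono fun s hs => ?_⟩
  simp only [slack, hs]
  ring

/-! ### Geometric sequences of integral combinations -/

lemma sum_Ico_lt_of_two_mul_le {v : ℕ → ℝ} {q : ℕ} (hpos : ∀ i < q, 0 < v i)
    (hle : ∀ i, i + 1 < q → 2 * v (i + 1) ≤ v i) {j : ℕ} (hj : j < q) :
    ∑ i ∈ Finset.Ico (j + 1) q, v i < v j := by
  induction hn : q - j generalizing j with
  | zero => omega
  | succ n ih =>
    rcases Nat.lt_or_ge (j + 1) q with h | h
    · rw [Finset.sum_eq_sum_Ico_succ_bot h]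
      have h1 := ih h (by omega)
      have h2 := hle j h
      linarith
    · rw [Finset.Ico_eq_empty (by omega), Finset.sum_empty]
      exact hpos j hj

lemma sum_lt_sum_of_mem_of_forall_lt {v : ℕ → ℝ} {q : ℕ} (hpos : ∀ i < q, 0 < v i)
    (hle : ∀ i, i + 1 < q → 2 * v (i + 1) ≤ v i) {F G : Finset ℕ} (hF : F ⊆ Finset.range q)
    (hG : G ⊆ Finset.range q) {j : ℕ} (hjF : j ∈ F) (hjG : j ∉ G)
    (hmin : ∀ i < j, i ∈ G → i ∈ F) : ∑ i ∈ G, v i < ∑ i ∈ F, v i := by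
  rw [← Finset.sum_sdiff_lt_sum_sdiff]
  have hjq := Finset.mem_range.1 (hF hjF)
  calc ∑ i ∈ G \ F, v i ≤ ∑ i ∈ Finset.Ico (j + 1) q, v i := by
        refine Finset.sum_le_sum_of_subset_of_nonneg (fun i hi => ?_) fun i hi _ =>
          (hpos i (Finset.mem_Ico.1 hi).2).le
        rw [Finset.mem_sdiff] at hi
        have h1 := Finset.mem_range.1 (hG hi.1)
        have h2 : ¬ i < j := fun h => hi.2 (hmin i h hi.1)
        have h3 : i ≠ j := fun h => hjG (h ▸ hi.1)
        exact Finset.mem_Ico.2 ⟨by omega, h1⟩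
    _ < v j := sum_Ico_lt_of_two_mul_le hpos hle hjq
    _ ≤ ∑ i ∈ F \ G, v i := by
        refine Finset.single_le_sum (f := v) (fun i hi => ?_) (Finset.mem_sdiff.2 ⟨hjF, hjG⟩)
        exact (hpos i (Finset.mem_range.1 (hF (Finset.mem_sdiff.1 hi).1))).le

/-- A form of Radzik's lemma: a sequence of integral combinations of the reals `c a` with small
coefficients can be halved only few times. Since the values decrease geometrically, the `2 ^ q`
partial sums of the sequence are distinct, hence so are their coefficient vectors, which lie in a
small box. -/
theorem two_pow_le_of_geometric {x : ℕ → A → ℤ} {c : A → ℝ} {q B : ℕ}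
    (hx : ∀ i < q, ∀ a, |x i a| ≤ B) (hpos : ∀ i < q, 0 < ∑ a, x i a * c a)
    (hle : ∀ i, i + 1 < q → 2 * ∑ a, x (i + 1) a * c a ≤ ∑ a, x i a * c a) :
    2 ^ q ≤ (2 * q * B + 1) ^ Fintype.card A := by
  classical
  have hcard := Finset.card_le_card_of_injOn (s := (Finset.range q).powerset)
    (t := Fintype.piFinset fun _ : A => Finset.Icc (-(q * B : ℤ)) (q * B))
    (fun F a => ∑ i ∈ F, x i a) (fun F hF => ?_) (fun F hF G hG hFG => ?_)
  · rw [Finset.card_powerset, Finset.card_range, Fintype.card_piFinset, Finset.prod_const,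
      Finset.card_univ, Int.card_Icc] at hcard
    convert hcard using 2
    rw [show (q * B : ℤ) + 1 - -(q * B) = ((2 * q * B + 1 : ℕ) : ℤ) by push_cast; ring]
    exact (Int.toNat_natCast _).symm
  · have hF' := Finset.mem_powerset.1 hF
    simp only [Finset.mem_coe, Fintype.mem_piFinset, Finset.mem_Icc]
    intro a
    rw [← abs_le]
    calc |∑ i ∈ F, x i a| ≤ ∑ i ∈ F, |x i a| := Finset.abs_sum_le_sum_abs _ _
      _ ≤ ∑ _i ∈ F, (B : ℤ) :=
          Finset.sum_le_sum fun i hi => hx i (Finset.mem_range.1 (hF' hi)) a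
      _ = F.card * B := by simp
      _ ≤ q * B := by
          have : F.card ≤ q := by simpa using Finset.card_le_card hF'
          gcongr
  · have hF' := Finset.mem_powerset.1 (Finset.mem_coe.1 hF)
    have hG' := Finset.mem_powerset.1 (Finset.mem_coe.1 hG)
    have hsum : ∀ H : Finset ℕ, ∑ i ∈ H, ∑ a, (x i a : ℝ) * c a =
        ∑ a, ((∑ i ∈ H, x i a : ℤ) : ℝ) * c a := by
      intro H
      rw [Finset.sum_comm]
      push_cast
      simp only [Finset.sum_mul]
    have heq : ∑ i ∈ F, ∑ a, (x i a : ℝ) * c a = ∑ i ∈ G, ∑ a, (x i a : ℝ) * c a := by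
      rw [hsum, hsum]
      exact Finset.sum_congr rfl fun a _ => by rw [show ∑ i ∈ F, x i a = _ from congrFun hFG a]
    by_contra hne
    have hD : (symmDiff F G).Nonempty := by
      rw [Finset.nonempty_iff_ne_empty, Ne, ← Finset.bot_eq_empty, symmDiff_eq_bot]
      exact hne
    have hj := Finset.min'_mem _ hD
    have hjmin : ∀ i < (symmDiff F G).min' hD, (i ∈ F ↔ i ∈ G) := by
      intro i hi
      by_contra h
      refine absurd (Finset.min'_le _ i ?_) (not_le.2 hi)
      rw [Finset.mem_symmDiff]
      tauto
    rcases Finset.mem_symmDiff.1 hj with ⟨h1, h2⟩ | ⟨h1, h2⟩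
    · exact (sum_lt_sum_of_mem_of_forall_lt hpos hle hF' hG' h1 h2
        fun i hi h => (hjmin i hi).2 h).ne' heq
    · exact (sum_lt_sum_of_mem_of_forall_lt hpos hle hG' hF' h1 h2
        fun i hi h => (hjmin i hi).1 h).ne heq

lemma le_of_two_pow_le {q m : ℕ} (h : 2 ^ q ≤ (2 * q * 6 + 1) ^ m) :
    (q : ℝ) ≤ 21 * (m * Real.log m) + 9 := by
  rcases Nat.eq_zero_or_pos m with rfl | hm
  · have : q = 0 := by
      by_contra hq
      have := Nat.one_lt_two_pow hq
      simp at h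
      omega
    simp [this]
  have hm1 : (1 : ℝ) ≤ m := by exact_mod_cast hm
  have hm0 : (0 : ℝ) < m := by linarith
  have hlm : 0 ≤ Real.log m := Real.log_nonneg hm1
  rcases Nat.eq_zero_or_pos q with rfl | hq
  · push_cast; positivity
  have hq1 : (1 : ℝ) ≤ q := by exact_mod_cast hq
  have hq0 : (0 : ℝ) < q := by linarith
  have h1 : (q : ℝ) * Real.log 2 ≤ m * Real.log (2 * q * 6 + 1) := by
    have h' : (2 : ℝ) ^ q ≤ (2 * q * 6 + 1) ^ m := by exact_mod_cast h
    have := Real.log_le_log (by positivity) h'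
    rwa [Real.log_pow, Real.log_pow] at this
  -- `log (13 q) = log m + log 52 + log (q / (4 m))`, and the last term is at most `q / (4 m) - 1`.
  have h2 : Real.log (2 * q * 6 + 1) ≤ Real.log m + 4 + (q / (4 * m) - 1) := by
    have h52 : Real.log 52 ≤ 4 := by
      rw [Real.log_le_iff_le_exp (by norm_num)]
      have := Real.exp_one_gt_d9
      calc (52 : ℝ) ≤ 2.7 ^ 4 := by norm_num
        _ ≤ Real.exp 1 ^ 4 := by gcongr; linarith
        _ = Real.exp 4 := by rw [← Real.exp_nat_mul]; norm_num
    calc Real.log (2 * q * 6 + 1) ≤ Real.log (m * 52 * (q / (4 * m))) := by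
          refine Real.log_le_log (by positivity) ?_
          field_simp
          linarith
      _ = Real.log m + Real.log 52 + Real.log (q / (4 * m)) := by
          rw [Real.log_mul (by positivity) (by positivity),
            Real.log_mul (by positivity) (by positivity)]
      _ ≤ Real.log m + 4 + (q / (4 * m) - 1) := by
          gcongr
          exact Real.log_le_sub_one_of_pos (by positivity)
  have h3 : (m : ℝ) * (Real.log m + 4 + (q / (4 * m) - 1)) = m * Real.log m + 3 * m + q / 4 := by
    field_simp
    ring
  have h4 : (m : ℝ) ≤ 2 * (m * Real.log m) + 1 := by
    rcases Nat.lt_or_ge m 2 with h | h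
    · have : m = 1 := by omega
      subst this
      simp
    · have : Real.log 2 ≤ Real.log m := Real.log_le_log (by norm_num) (by exact_mod_cast h)
      have := Real.log_two_gt_d9
      nlinarith
  have h5 := mul_le_mul_of_nonneg_left h2 hm0.le
  have h6 := Real.log_two_gt_d9
  nlinarith

/-! ### Submodular functions on ring families -/

section Ring

variable {V : Type*} [DecidableEq V]

lemma card_mul_card_sdiff_le {S W : Finset V} (h : S ⊆ W) :
    (S.card : ℝ) * (W \ S).card ≤ (W.card : ℝ) ^ 2 / 4 := by
  have : (W.card : ℝ) = S.card + (W \ S).card := by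
    rw [add_comm]
    exact_mod_cast (Finset.card_sdiff_add_card_eq_card h).symm
  rw [this]
  nlinarith [sq_nonneg ((S.card : ℝ) - (W \ S).card)]

/-- Let `f` be nonnegative and submodular on the subsets of `W`. If each `v ∈ S` can be separated
from each `u ∈ W \ S` by a set on which `f` is at most `M`, then `S` is a union of intersections
of such sets, so that `f S` is at most `(|W|² / 4) * M`. -/
lemma le_of_separated {W : Finset V} {f : Finset V → ℝ} {M : ℝ} (hM : 0 ≤ M)
    (h0 : ∀ T ⊆ W, 0 ≤ f T)
    (hsub : ∀ S ⊆ W, ∀ T ⊆ W, f (S ∪ T) + f (S ∩ T) ≤ f S + f T) {S : Finset V} (hS : S ⊆ W)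
    (hne : S.Nonempty) (hne' : (W \ S).Nonempty)
    (hsep : ∀ v ∈ S, ∀ u ∈ W \ S, ∃ T ⊆ W, v ∈ T ∧ u ∉ T ∧ f T ≤ M) :
    f S ≤ (W.card : ℝ) ^ 2 / 4 * M := by
  choose! T hTW hvT huT hTM using hsep
  have hinter : ∀ v ∈ S, ∀ s : Finset V, s.Nonempty → s ⊆ W \ S →
      f (W.filter fun w => ∀ u ∈ s, w ∈ T v u) ≤ s.card * M := by
    intro v hv s hs
    induction hs using Finset.Nonempty.cons_induction with
    | singleton u =>
      intro hu
      have hu' := hu (Finset.mem_singleton_self u)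
      have : (W.filter fun w => ∀ u' ∈ ({u} : Finset V), w ∈ T v u') = T v u := by
        ext w
        simp only [Finset.mem_filter, Finset.mem_singleton, forall_eq, and_iff_right_iff_imp]
        exact fun h => hTW v hv u hu' h
      rw [this]
      simpa using hTM v hv u hu'
    | cons u s hus hs ih =>
      intro hu
      have hu' := hu (Finset.mem_cons_self u s)
      have : (W.filter fun w => ∀ u' ∈ Finset.cons u s hus, w ∈ T v u') =
          T v u ∩ W.filter fun w => ∀ u' ∈ s, w ∈ T v u' := by
        ext w
        simp only [Finset.mem_filter, Finset.mem_cons, forall_eq_or_imp, Finset.mem_inter]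
        tauto
      rw [this, Finset.card_cons]
      have h1 := hsub _ (hTW v hv u hu') _ (Finset.filter_subset (fun w => ∀ u' ∈ s, w ∈ T v u') W)
      have h2 := h0 _ (Finset.union_subset (hTW v hv u hu')
        (Finset.filter_subset (fun w => ∀ u' ∈ s, w ∈ T v u') W))
      have h3 := ih fun x hx => hu (Finset.mem_cons_of_mem hx)
      have h4 := hTM v hv u hu'
      push_cast
      linarith
  let R : V → Finset V := fun v => W.filter fun w => ∀ u ∈ W \ S, w ∈ T v u
  have hR : ∀ v, R v ⊆ W := fun v => Finset.filter_subset _ _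
  have hunion : ∀ s : Finset V, s.Nonempty → s ⊆ S →
      f (s.biUnion R) ≤ s.card * ((W \ S).card * M) := by
    intro s hs
    induction hs using Finset.Nonempty.cons_induction with
    | singleton v =>
      intro hv
      rw [Finset.singleton_biUnion]
      rw [Finset.card_singleton, Nat.cast_one, one_mul]
      exact hinter v (hv (Finset.mem_singleton_self v)) _ hne' Finset.Subset.rfl
    | cons v s hvs hs ih =>
      intro hv
      have hW : s.biUnion R ⊆ W := Finset.biUnion_subset.2 fun v _ => hR v
      have h1 := hsub _ (hR v) _ hW
      have h2 := h0 _ (Finset.inter_subset_left.trans (hR v) : R v ∩ s.biUnion R ⊆ W)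
      have h3 := ih fun x hx => hv (Finset.mem_cons_of_mem hx)
      have h4 := hinter v (hv (Finset.mem_cons_self v s)) _ hne' Finset.Subset.rfl
      rw [Finset.cons_eq_insert, Finset.biUnion_insert, ← Finset.cons_eq_insert _ _ hvs,
        Finset.card_cons]
      push_cast
      linarith
  have hSR : S.biUnion R = S := by
    ext w
    simp only [Finset.mem_biUnion, Finset.mem_filter, R]
    constructor
    · rintro ⟨v, hv, hwW, hw⟩
      by_contra hwS
      have hw' := Finset.mem_sdiff.2 ⟨hwW, hwS⟩
      exact huT v hv w hw' (hw w hw')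
    · exact fun hw => ⟨w, hw, hS hw, fun u hu => hvT w hw u hu⟩
  have h1 := hunion S hne Finset.Subset.rfl
  rw [hSR, ← mul_assoc] at h1
  exact h1.trans (mul_le_mul_of_nonneg_right (card_mul_card_sdiff_le hS) hM)

end Ring

/-! ### The functions `d^θ` and `d` -/

section Slack

variable (N : Network V A) (b : V → ℝ)

lemma minSlack_le {S : Finset V} (hS : S ⊆ N.terminals) (θ : ℝ) :
    N.minSlack b θ ≤ N.slack b θ S :=
  Finset.inf'_le _ (Finset.mem_powerset.2 hS)

lemma cut_eq_of_forall_not_isBreakpoint {S : Finset V} {x y u v : ℝ} (hu : 0 < u)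
    (hx : x ∈ Icc u v) (hy : y ∈ Icc u v)
    (h : ∀ t ∈ Icc u v, ¬ IsBreakpoint (fun s => N.slack b s S) t) :
    N.cut b x S = N.cut b y S := by
  have key : ∀ t ∈ Icc u v, ∃ p q : ℝ, ∀ᶠ s in nhds t, N.slack b s S = p * s + q := by
    intro t ht
    by_contra hcon
    exact h t ht ⟨hu.trans_le ht.1, hcon⟩
  refine isPreconnected_Icc.induction₂ (fun x y => N.cut b x S = N.cut b y S) (fun t ht => ?_)
    (fun _ _ _ _ _ _ h1 h2 => h1.trans h2) (fun _ _ _ _ h => h.symm) hx hy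
  obtain ⟨p, q, hpq⟩ := key t ht
  have hcut : ∀ᶠ s in nhds t, N.cut b s S = p := by
    filter_upwards [hpq.eventually_nhds] with s hs
    have h1 : HasDerivAt (fun r => p * r + q) p s := by
      simpa using ((hasDerivAt_id s).const_mul p).add_const q
    exact (h1.congr_of_eventuallyEq hs).hasDerivWithinAt.derivWithin
      (uniqueDiffOn_Iic s s self_mem_Iic)
  exact (hcut.mono fun s hs => hcut.self_of_nhds.trans hs.symm).filter_mono nhdsWithin_le_nhds

variable [Fintype V]

lemma monotoneOn_slack (S : Finset V) : MonotoneOn (fun t => N.slack b t S) (Ici 0) :=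
  fun _ hs _ ht h => sub_le_sub_right (N.monotoneOn_maxFlow S hs ht h) _

lemma convexOn_slack (S : Finset V) : ConvexOn ℝ (Ici 0) fun t => N.slack b t S := by
  simp only [slack, sub_eq_add_neg]
  exact (N.convexOn_maxFlow S).add_const (-∑ v ∈ S, b v)

lemma slack_submodular {θ : ℝ} (hθ : 0 ≤ θ) (S T : Finset V) :
    N.slack b θ (S ∪ T) + N.slack b θ (S ∩ T) ≤ N.slack b θ S + N.slack b θ T := by
  have h1 := N.maxFlow_submodular hθ S T
  have h2 := Finset.sum_union_inter (s₁ := S) (s₂ := T) (f := b)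
  unfold slack
  linarith

lemma maxFlow_eq_zero {θ c : ℝ} {S : Finset V} (hθ : 0 ≤ θ)
    (h : IsPotential (N.sources ∩ S) (N.sinks \ S) θ fun _ => c) : N.maxFlow θ S = 0 := by
  refine le_antisymm ((N.maxFlow_le_dualCost h).trans_eq ?_) ?_
  · refine Finset.sum_eq_zero fun a _ => ?_
    rw [max_eq_left, mul_zero]
    linarith [N.transit_nonneg a]
  · simpa [flowValue_zero] using N.flowValue_le_maxFlow hθ (N.isFlowOverTime_zero _ _ θ)

lemma slack_empty {θ : ℝ} (hθ : 0 ≤ θ) : N.slack b θ ∅ = 0 := by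
  rw [slack, N.maxFlow_eq_zero (c := θ) hθ ⟨by simp, by simp⟩]
  simp

lemma slack_terminals (hb : N.IsSupply b) {θ : ℝ} (hθ : 0 ≤ θ) : N.slack b θ N.terminals = 0 := by
  rw [slack, N.maxFlow_eq_zero (c := 0) hθ ⟨by simp, ?_⟩, hb.balanced, sub_zero]
  intro v hv
  rw [Finset.mem_sdiff] at hv
  exact absurd (Finset.mem_union_right _ hv.1) hv.2

lemma monotoneOn_minSlack : MonotoneOn (N.minSlack b) (Ici 0) := by
  intro s hs t ht h
  refine Finset.le_inf' _ _ fun S hS => ?_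
  exact (N.minSlack_le b (Finset.mem_powerset.1 hS) s).trans (N.monotoneOn_slack b S hs ht h)

lemma hasDerivWithinAt_slack {s : ℝ} (hs : 0 < s) (S : Finset V) :
    HasDerivWithinAt (fun t => N.slack b t S) (N.cut b s S) (Iio s) s := by
  have h := (N.convexOn_slack b S).hasDerivWithinAt_leftDeriv_of_mem_interior (x := s)
    (by rwa [interior_Ici])
  have h' : N.cut b s S = derivWithin (fun t => N.slack b t S) (Iio s) s :=
    (hasDerivWithinAt_Iio_iff_Iic.1 h).derivWithin (uniqueDiffOn_Iic s s self_mem_Iic)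
  rwa [h']

/-- The left tangent of the convex function `t ↦ d^t(S)` lies below it. -/
lemma add_cut_mul_le_slack {s t : ℝ} (hs : 0 < s) (ht : 0 ≤ t) (S : Finset V) :
    N.slack b s S + N.cut b s S * (t - s) ≤ N.slack b t S := by
  have hc := N.convexOn_slack b S
  have hint : s ∈ interior (Ici (0 : ℝ)) := by rwa [interior_Ici]
  have hd := N.hasDerivWithinAt_slack b hs S
  rcases lt_trichotomy t s with h | rfl | h
  · have := hc.slope_le_of_hasDerivWithinAt_Iio ht hs.le h hd
    rw [slope_def_field, div_le_iff₀ (sub_pos.2 h)] at this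
    linarith
  · simp
  · have h1 := hc.leftDeriv_le_rightDeriv_of_mem_interior hint
    rw [hd.derivWithin (uniqueDiffWithinAt_Iio s)] at h1
    have h2 := h1.trans (hc.rightDeriv_le_slope_of_mem_interior hint ht h)
    rw [slope_def_field, le_div_iff₀ (sub_pos.2 h)] at h2
    linarith

end Slack

/-! ### Executions of the algorithm -/

/-- The pairs of terminals that are separated by one of the sets `S j` with `l ≤ j`. They describe
the ring family generated by these sets. -/
def separated {V A : Type*} [DecidableEq V] (N : Network V A) (K : ℕ) (S : ℕ → Finset V)
    (l : ℕ) : Finset (V × V) :=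
  open Classical in
  (N.terminals ×ˢ N.terminals).filter fun p => ∃ j, l ≤ j ∧ j < K ∧ p.1 ∈ S j ∧ p.2 ∉ S j

lemma separated_anti {V A : Type*} [DecidableEq V] (N : Network V A) (K : ℕ) (S : ℕ → Finset V) :
    Antitone (separated N K S) := by
  intro l l' hl p hp
  simp only [separated, Finset.mem_filter] at hp ⊢
  obtain ⟨h, j, h1, h2⟩ := hp
  exact ⟨h, j, hl.trans h1, h2⟩

lemma card_separated_le {V A : Type*} [DecidableEq V] (N : Network V A) (K : ℕ) (S : ℕ → Finset V)
    (l : ℕ) :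
    (separated N K S l).card ≤ N.numTerminals ^ 2 := by
  classical
  refine (Finset.card_filter_le _ _).trans ?_
  rw [Finset.card_product, sq]
  rfl

lemma le_two_pow_maxExponent {V A : Type*} [DecidableEq V] (N : Network V A)
    (hk : 0 < N.numTerminals) :
    (N.numTerminals : ℝ) ^ 2 / 4 ≤ 2 ^ N.maxExponent := by
  have hk' : (0 : ℝ) < (N.numTerminals : ℝ) ^ 2 / 4 := by positivity
  rw [← Real.rpow_natCast 2 N.maxExponent, ← Real.logb_le_iff_le_rpow (by norm_num) hk']
  exact Nat.le_ceil _

namespace IsExecution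

variable {N : Network V A} {b : V → ℝ} {K : ℕ} {θ θ' : ℕ → ℝ} {S : ℕ → Finset V}

lemma le_next (h : N.IsExecution b K θ θ' S) {i : ℕ} (hi : i < K) : θ' i ≤ θ (i + 1) :=
  (h.next i hi).2 (Or.inl rfl)

lemma slack_neg (h : N.IsExecution b K θ θ' S) {i : ℕ} (hi : i < K) :
    N.slack b (θ i) (S i) < 0 := by
  rw [h.minimizer i hi]; exact h.guard i hi

lemma slack_first_zero (h : N.IsExecution b K θ θ' S) {i : ℕ} (hi : i < K) :
    N.slack b (θ' i) (S i) = 0 := (h.first_zero i hi).1.2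

lemma minSlack_jump_nonneg (h : N.IsExecution b K θ θ' S) {i : ℕ} (hi : i < K) {r : ℕ}
    (hr : r ≤ N.maxExponent) (hlt : θ (i + 1) < N.jump b (θ' i) (S i) (2 ^ r)) :
    0 ≤ N.minSlack b (N.jump b (θ' i) (S i) (2 ^ r)) := by
  by_contra! hneg
  exact absurd ((h.next i hi).2 (Or.inr ⟨hneg, r, hr, rfl⟩)) (not_le.2 hlt)

lemma nonneg (h : N.IsExecution b K θ θ' S) {i : ℕ} (hi : i ≤ K) : 0 ≤ θ i := by
  cases i with
  | zero => exact h.init.ge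
  | succ i => exact (h.first_zero i hi).1.1.trans (h.le_next hi)

variable [Fintype V]

lemma lt_first_zero (h : N.IsExecution b K θ θ' S) {i : ℕ} (hi : i < K) : θ i < θ' i := by
  by_contra! hle
  have := N.monotoneOn_slack b (S i) (h.first_zero i hi).1.1 (h.nonneg hi.le) hle
  beta_reduce at this
  rw [h.slack_first_zero hi] at this
  exact absurd (h.slack_neg hi) (not_lt.2 this)

lemma first_zero_pos (h : N.IsExecution b K θ θ' S) {i : ℕ} (hi : i < K) : 0 < θ' i :=
  (h.nonneg hi.le).trans_lt (h.lt_first_zero hi)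

lemma lt_next (h : N.IsExecution b K θ θ' S) {i : ℕ} (hi : i < K) : θ i < θ (i + 1) :=
  (h.lt_first_zero hi).trans_le (h.le_next hi)

lemma time_le (h : N.IsExecution b K θ θ' S) {i j : ℕ} (hij : i ≤ j) (hj : j ≤ K) :
    θ i ≤ θ j := by
  induction hij with
  | refl => exact le_rfl
  | step _ ih => exact (ih (Nat.le_of_succ_le hj)).trans (h.lt_next hj).le

lemma time_lt (h : N.IsExecution b K θ θ' S) {i j : ℕ} (hij : i < j) (hj : j ≤ K) :
    θ i < θ j :=
  (h.lt_next (hij.trans_le hj)).trans_le (h.time_le hij hj)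

lemma neg_minSlack_le (h : N.IsExecution b K θ θ' S) {i : ℕ} (hi : i < K) :
    -N.minSlack b (θ i) ≤ N.cut b (θ' i) (S i) * (θ' i - θ i) := by
  have := N.add_cut_mul_le_slack b (h.first_zero_pos hi) (h.nonneg hi.le) (S i)
  rw [h.slack_first_zero hi, h.minimizer i hi] at this
  linarith

lemma cut_pos (h : N.IsExecution b K θ θ' S) {i : ℕ} (hi : i < K) :
    0 < N.cut b (θ' i) (S i) := by
  have h1 := h.neg_minSlack_le hi
  have h2 := h.guard i hi
  exact pos_of_mul_pos_left (by linarith) (sub_pos.2 (h.lt_first_zero hi)).le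

lemma cut_mul_le_slack (h : N.IsExecution b K θ θ' S) {i : ℕ} (hi : i < K) {t : ℝ} (ht : 0 ≤ t) :
    N.cut b (θ' i) (S i) * (t - θ' i) ≤ N.slack b t (S i) := by
  have := N.add_cut_mul_le_slack b (h.first_zero_pos hi) ht (S i)
  rwa [h.slack_first_zero hi, zero_add] at this

/-- After an iteration whose jump is not the longest possible one, the time that the execution still
has to cover is at most the time that this iteration has covered: the next longer jump would have
been too long. -/
lemma sub_le_sub_of_notMem (h : N.IsExecution b K θ θ' S) {i : ℕ} (hi : i + 1 < K)
    (hnot : i ∉ N.iterations1 b K θ θ' S) {t : ℝ} (ht0 : 0 ≤ t) (ht : N.minSlack b t < 0) :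
    t - θ (i + 1) ≤ θ (i + 1) - θ i := by
  have hiK : i < K := by omega
  have hg := h.cut_pos hiK
  have hz := h.first_zero_pos hiK
  have hle := h.le_next hiK
  have hlt := h.lt_first_zero hiK
  have hmono := N.monotoneOn_minSlack b
  have hneg : N.minSlack b (θ' i) < 0 :=
    (hmono hz.le (h.nonneg hi.le) hle).trans_lt (h.guard (i + 1) hi)
  set D := -N.minSlack b (θ' i) / N.cut b (θ' i) (S i) with hD
  have hD0 : 0 < D := div_pos (by linarith) hg
  have hjump : ∀ r : ℕ, N.jump b (θ' i) (S i) (2 ^ r) = θ' i + 2 ^ r * D := fun r => rfl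
  have hbound : ∀ r : ℕ, r ≤ N.maxExponent → θ (i + 1) < θ' i + 2 ^ r * D →
      t < θ' i + 2 ^ r * D := by
    intro r hr hlt'
    rw [← hjump] at hlt' ⊢
    by_contra! hcon
    have h1 := h.minSlack_jump_nonneg hiK hr hlt'
    have h2 : 0 ≤ N.jump b (θ' i) (S i) (2 ^ r) := (h.nonneg hi.le).trans hlt'.le
    exact absurd (hmono h2 ht0 hcon) (not_le.2 (ht.trans_le h1))
  by_cases heq : θ (i + 1) = θ' i
  · have h1 := hbound 0 (Nat.zero_le _) (by rw [heq]; linarith)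
    have h2 : D ≤ θ' i - θ i := by
      rw [hD, div_le_iff₀ hg, mul_comm]
      refine le_trans ?_ (h.neg_minSlack_le hiK)
      exact neg_le_neg (hmono (h.nonneg hiK.le) hz.le hlt.le)
    rw [heq]
    rw [pow_zero, one_mul] at h1
    linarith
  · rcases (h.next i hiK).1 with h1 | ⟨-, r, hr, hrj⟩
    · exact absurd h1 heq
    have hrmax : r ≠ N.maxExponent := fun h' => hnot ⟨hiK, heq, by rw [hrj, h']⟩
    rw [hjump] at hrj
    have hpos : 0 < (2 : ℝ) ^ r * D := by positivity
    have h2 := hbound (r + 1) (by omega) (by rw [hrj, pow_succ]; linarith)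
    rw [pow_succ] at h2
    linarith

/-- If iteration `i` separates no pair of terminals that is not separated again from iteration `l`
on, then `S i` lies in the ring family generated by the later sets, on which `d^{θ_l}` is small. -/
lemma slack_le_of_separated (h : N.IsExecution b K θ θ' S) (hb : N.IsSupply b) {i l : ℕ}
    (hi : i < K) (hl : l < K) (hsep : separated N K S i ⊆ separated N K S l) :
    N.slack b (θ l) (S i) - N.minSlack b (θ l) ≤
      (N.numTerminals : ℝ) ^ 2 / 4 * -N.minSlack b (θ l) := by
  classical
  have hneg := h.guard l hl
  have hl0 := h.nonneg hl.le
  have hneg_i := h.slack_neg hi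
  refine le_of_separated (W := N.terminals)
    (f := fun T => N.slack b (θ l) T - N.minSlack b (θ l)) (by linarith)
    (fun T hT => sub_nonneg.2 (N.minSlack_le b hT _)) (fun T _ T' _ => ?_) (h.subset i hi) ?_ ?_ ?_
  · have := N.slack_submodular b hl0 T T'
    linarith
  · rw [Finset.nonempty_iff_ne_empty]
    intro h0
    rw [h0, N.slack_empty b (h.nonneg hi.le)] at hneg_i
    exact lt_irrefl _ hneg_i
  · rw [Finset.sdiff_nonempty]
    intro h0
    rw [(h.subset i hi).antisymm h0, N.slack_terminals b hb (h.nonneg hi.le)] at hneg_i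
    exact lt_irrefl _ hneg_i
  · intro v hv u hu
    rw [Finset.mem_sdiff] at hu
    have hp : (v, u) ∈ separated N K S i :=
      Finset.mem_filter.2 ⟨Finset.mem_product.2 ⟨h.subset i hi hv, hu.1⟩, i, le_rfl, hi, hv, hu.2⟩
    obtain ⟨-, j, hlj, hj, hvj, huj⟩ := Finset.mem_filter.1 (hsep hp)
    refine ⟨S j, h.subset j hj, hvj, huj, ?_⟩
    -- The zero `θ' j` of the increasing function `d^t(S j)` is not before `θ l`.
    have := N.monotoneOn_slack b (S j) hl0 (h.first_zero_pos hj).le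
      ((h.time_le hlj hj.le).trans (h.lt_first_zero hj).le)
    beta_reduce at this
    rw [h.slack_first_zero hj] at this
    linarith

/-- An iteration with the longest possible jump separates a pair of terminals for the last time. -/
lemma separated_ne_of_mem_iterations1 (h : N.IsExecution b K θ θ' S) (hb : N.IsSupply b) {i : ℕ}
    (hi : i + 1 < K) (hmem : i ∈ N.iterations1 b K θ θ' S) :
    separated N K S (i + 1) ≠ separated N K S i := by
  intro heq
  obtain ⟨hiK, -, hjump⟩ := hmem
  have h1 := h.slack_le_of_separated hb hiK hi heq.ge
  have h2 := h.cut_mul_le_slack hiK (h.nonneg hi.le)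
  have hg := h.cut_pos hiK
  have hneg := h.guard (i + 1) hi
  have hk : 0 < N.numTerminals := by
    rw [Nat.pos_iff_ne_zero]
    intro h0
    have hS := h.subset i hiK
    rw [Finset.card_eq_zero.1 h0, Finset.subset_empty] at hS
    have := h.slack_neg hiK
    rw [hS, N.slack_empty b (h.nonneg hiK.le)] at this
    exact lt_irrefl _ this
  have h3 : N.cut b (θ' i) (S i) * (θ (i + 1) - θ' i) =
      2 ^ N.maxExponent * -N.minSlack b (θ' i) := by
    rw [hjump, jump]
    field_simp
    ring
  have h4 := N.monotoneOn_minSlack b (h.first_zero_pos hiK).le (h.nonneg hi.le) (h.le_next hiK)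
  have h5 : (N.numTerminals : ℝ) ^ 2 / 4 * -N.minSlack b (θ (i + 1)) ≤
      2 ^ N.maxExponent * -N.minSlack b (θ' i) :=
    mul_le_mul (le_two_pow_maxExponent N hk) (by linarith) (by linarith) (by positivity)
  linarith

end IsExecution

/-! ### Iterations of the second and of the third kind -/

/-- A decreasing sequence of finite sets drops at most as often as the first set has elements. -/
lemma card_drops_add_card_le {B : Type*} [DecidableEq B] {E : ℕ → Finset B} (hE : Antitone E)
    [DecidablePred fun i => E (i + 1) ≠ E i] (n : ℕ) :
    ((Finset.range n).filter fun i => E (i + 1) ≠ E i).card + (E n).card ≤ (E 0).card := by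
  induction n with
  | zero => simp
  | succ n ih =>
    rw [Finset.range_add_one, Finset.filter_insert]
    split_ifs with hne
    · rw [Finset.card_insert_of_notMem (by simp)]
      have := Finset.card_lt_card ((hE (Nat.le_add_right n 1)).lt_of_ne hne)
      omega
    · have := Finset.card_le_card (hE (Nat.le_add_right n 1))
      omega

namespace IsExecution

variable {N : Network V A} {b : V → ℝ} {K : ℕ} {θ θ' : ℕ → ℝ} {S : ℕ → Finset V}

lemma not_isBreakpoint_of_mem_iterations3 {i : ℕ} (hi : i ∈ N.iterations3 b K θ θ' S)
    {T : Finset V} (hT : T ⊆ N.terminals) :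
    ∀ t ∈ Icc (θ i) (θ (i + 1)), ¬ IsBreakpoint (fun s => N.slack b s T) t := by
  intro t ht hbp
  exact hi.2 (Or.inr ⟨hi.1, fun h1 => hi.2 (Or.inl h1), T, hT, t, ht, hbp⟩)

variable [Fintype V]

/-- As long as no breakpoint is met, all functions `d^t(T)` are affine, and the slopes of the sets
that the algorithm picks decrease as in the usual discrete Newton method. -/
lemma cut_succ_le (h : N.IsExecution b K θ θ' S) {i : ℕ} (hi0 : 0 < i) (hi : i + 1 < K)
    (hi3 : i ∈ N.iterations3 b K θ θ' S) (hi3' : i + 1 ∈ N.iterations3 b K θ θ' S) :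
    N.cut b (θ' (i + 1)) (S (i + 1)) ≤ N.cut b (θ' i) (S i) := by
  have hiK : i < K := by omega
  have hpos : 0 < θ i := h.init ▸ h.time_lt hi0 hiK.le
  have hpos' : 0 < θ (i + 1) := hpos.trans (h.lt_next hiK)
  have hS := h.subset i hiK
  have hS' := h.subset (i + 1) hi
  have e1 : N.cut b (θ' i) (S i) = N.cut b (θ (i + 1)) (S i) :=
    N.cut_eq_of_forall_not_isBreakpoint b hpos ⟨(h.lt_first_zero hiK).le, h.le_next hiK⟩
      ⟨(h.lt_next hiK).le, le_rfl⟩ (not_isBreakpoint_of_mem_iterations3 hi3 hS)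
  have e2 : N.cut b (θ' (i + 1)) (S (i + 1)) = N.cut b (θ (i + 1)) (S (i + 1)) :=
    N.cut_eq_of_forall_not_isBreakpoint b hpos' ⟨(h.lt_first_zero hi).le, h.le_next hi⟩
      ⟨le_rfl, (h.lt_next hi).le⟩ (not_isBreakpoint_of_mem_iterations3 hi3' hS')
  have e3 : N.cut b (θ (i + 1)) (S (i + 1)) = N.cut b (θ i) (S (i + 1)) :=
    N.cut_eq_of_forall_not_isBreakpoint b hpos ⟨(h.lt_next hiK).le, le_rfl⟩
      ⟨le_rfl, (h.lt_next hiK).le⟩ (not_isBreakpoint_of_mem_iterations3 hi3 hS')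
  rw [e1, e2, e3]
  have t1 := N.add_cut_mul_le_slack b hpos' hpos.le (S i)
  have t2 := N.add_cut_mul_le_slack b hpos hpos'.le (S (i + 1))
  have m1 := N.minSlack_le b hS' (θ i)
  have m2 := N.minSlack_le b hS (θ (i + 1))
  rw [← h.minimizer i hiK] at m1
  rw [← h.minimizer (i + 1) hi] at m2
  have hd : 0 < θ (i + 1) - θ i := sub_pos.2 (h.lt_next hiK)
  by_contra! hcon
  have := mul_lt_mul_of_pos_right hcon hd
  linarith

lemma two_mul_sub_le (h : N.IsExecution b K θ θ' S) {i : ℕ} (hi : i + 1 < K)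
    (hnot : i ∉ N.iterations1 b K θ θ' S) :
    2 * (θ (K - 1) - θ (i + 1)) ≤ θ (K - 1) - θ i := by
  have := h.sub_le_sub_of_notMem hi hnot (h.nonneg (Nat.sub_le K 1))
    (h.guard (K - 1) (by omega))
  linarith

/-- During `2 * ⌈log₂ k⌉ + 2` consecutive iterations of the third kind some pair of terminals is
separated for the last time. Write `r j` for the time that remains from `θ j` on, which is halved by
each iteration. If the first set `S i` of the run were in the ring family of the sets from the last
iteration `l` of the run on, then its slack at `θ l`, which is at least `cut * (r (i + 1) - r l)`,
would be at most `(k² / 4) * (-d(θ l)) ≤ (k² / 4) * cut * r l`. -/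
lemma separated_ne_of_run (h : N.IsExecution b K θ θ' S) (hb : N.IsSupply b)
    (hk : 2 ≤ N.numTerminals) {i : ℕ} (hi0 : 0 < i)
    (hiK : i + (2 * Nat.clog 2 N.numTerminals + 1) + 1 < K)
    (hrun : ∀ n ≤ 2 * Nat.clog 2 N.numTerminals + 1, i + n ∈ N.iterations3 b K θ θ' S) :
    separated N K S (i + (2 * Nat.clog 2 N.numTerminals + 1)) ≠ separated N K S i := by
  set L := 2 * Nat.clog 2 N.numTerminals with hL
  intro heq
  have hcut : ∀ n ≤ L + 1, N.cut b (θ' (i + n)) (S (i + n)) ≤ N.cut b (θ' i) (S i) := by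
    intro n
    induction n with
    | zero => intro _; exact le_rfl
    | succ n ih =>
      intro hn
      exact (h.cut_succ_le (i := i + n) (by omega) (by omega) (hrun n (by omega))
        (hrun (n + 1) hn)).trans (ih (by omega))
  have hhalf : ∀ n ≤ L, 2 ^ n * (θ (K - 1) - θ (i + 1 + n)) ≤ θ (K - 1) - θ (i + 1) := by
    intro n
    induction n with
    | zero => intro _; simp
    | succ n ih =>
      intro hn
      refine le_trans ?_ (ih (by omega))
      rw [pow_succ, mul_assoc]
      refine mul_le_mul_of_nonneg_left ?_ (by positivity)
      have hmem := hrun (n + 1) (by omega)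
      rw [← add_assoc, add_right_comm] at hmem
      exact h.two_mul_sub_le (i := i + 1 + n) (by omega) fun h1 => hmem.2 (Or.inl h1)
  set l := i + (L + 1) with hl
  have hl' : i + 1 + L = l := by omega
  have hlK : l < K := by omega
  have hiK' : i < K := by omega
  have hhalfL := hhalf L le_rfl
  rw [hl'] at hhalfL
  have h1 := h.slack_le_of_separated hb hiK' hlK heq.ge
  have h2 := h.cut_mul_le_slack hiK' (h.nonneg hlK.le)
  have h3 := h.neg_minSlack_le hlK
  have hg := h.cut_pos hiK'
  have hneg := h.guard l hlK
  have hle := hcut (L + 1) le_rfl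
  rw [← hl] at hle
  have hr : θ' l - θ l ≤ θ (K - 1) - θ l :=
    sub_le_sub_right ((h.le_next hlK).trans (h.time_le (by omega) (Nat.sub_le K 1))) _
  have hz : 0 ≤ θ' l - θ l := sub_nonneg.2 (h.lt_first_zero hlK).le
  set g := N.cut b (θ' i) (S i)
  set r := θ (K - 1) - θ l with hr_def
  have h4 : -N.minSlack b (θ l) ≤ g * r := h3.trans (mul_le_mul hle hr hz hg.le)
  have hpow : (N.numTerminals : ℝ) ^ 2 ≤ 2 ^ L := by
    have : N.numTerminals ≤ 2 ^ Nat.clog 2 N.numTerminals := Nat.le_pow_clog (by norm_num) _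
    rw [hL, mul_comm, pow_mul]
    gcongr
    exact_mod_cast this
  have hk2 : (2 : ℝ) ≤ N.numTerminals := by exact_mod_cast hk
  have hk4 : (4 : ℝ) ≤ (N.numTerminals : ℝ) ^ 2 := by nlinarith
  have hgr : 0 < g * r := by linarith
  have hr0 : 0 < r := pos_of_mul_pos_right hgr hg.le
  have h5 : g * (θ l - θ (i + 1)) ≤ g * (θ l - θ' i) :=
    mul_le_mul_of_nonneg_left (by linarith [h.le_next hiK']) hg.le
  have h6 : (2 ^ L - 1) * r ≤ θ l - θ (i + 1) := by linarith
  have h7 : ((N.numTerminals : ℝ) ^ 2 - 1) * r ≤ (2 ^ L - 1) * r :=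
    mul_le_mul_of_nonneg_right (by linarith) hr0.le
  have h8 : g * (((N.numTerminals : ℝ) ^ 2 - 1) * r) ≤ g * (θ l - θ (i + 1)) :=
    mul_le_mul_of_nonneg_left (h7.trans h6) hg.le
  have h9 : (N.numTerminals : ℝ) ^ 2 / 4 * -N.minSlack b (θ l) ≤
      (N.numTerminals : ℝ) ^ 2 / 4 * (g * r) := mul_le_mul_of_nonneg_left h4 (by positivity)
  have h10 : ((N.numTerminals : ℝ) ^ 2 - 1) * (g * r) <
      (N.numTerminals : ℝ) ^ 2 / 4 * (g * r) := by linarith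
  have h11 := lt_of_mul_lt_mul_right h10 hgr.le
  linarith

/-- The breakpoints met by the iterations of the second kind are small integral combinations of the
transit times. Each of these iterations halves the remaining time, so the distances between every
third of these breakpoints decrease geometrically, which leaves room for only `O(m log m)` of them.
-/
lemma card_iterations2_le (h : N.IsExecution b K θ θ' S) (I : Finset ℕ)
    (hI : ∀ i ∈ I, i + 1 < K ∧ i ∈ N.iterations2 b K θ θ' S) :
    (I.card : ℝ) ≤ 63 * (Fintype.card A * Real.log (Fintype.card A)) + 30 := by
  classical
  let e : ℕ → ℕ := Nat.nth (· ∈ I)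
  have hfin : {i | i ∈ I}.Finite := I.finite_toSet
  have hcard : hfin.toFinset.card = I.card := by congr 1; ext; simp
  have he : ∀ n < I.card, e n ∈ I := fun n hn => Nat.nth_mem_of_lt_card hfin (by rwa [hcard])
  have hlt : ∀ m n, m < n → n < I.card → e m < e n := fun m n hmn hn =>
    Nat.nth_lt_nth_of_lt_card hfin hmn (by rwa [hcard])
  have hbp : ∀ i ∈ I, ∃ (t : ℝ) (y : A → ℤ), t ∈ Icc (θ i) (θ (i + 1)) ∧ (∀ a, |y a| ≤ 3) ∧
      t = ∑ a, y a * N.transit a := by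
    intro i hi
    obtain ⟨-, -, T, -, t, ht, htb⟩ := (hI i hi).2
    obtain ⟨y, hy, hty⟩ := htb.exists_eq_sum
    exact ⟨t, y, ht, hy, hty⟩
  choose! t y ht hy hty using hbp
  let R : ℕ → ℝ := fun n => θ (K - 1) - t (e n)
  -- The remaining time at the breakpoint of the iteration `e n` lies between those at the end and
  -- at the start of this iteration.
  have hR1 : ∀ n < I.card, R n ≤ θ (K - 1) - θ (e n) := fun n hn =>
    sub_le_sub_left (ht _ (he n hn)).1 _
  have hR2 : ∀ n < I.card, θ (K - 1) - θ (e n + 1) ≤ R n := fun n hn =>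
    sub_le_sub_left (ht _ (he n hn)).2 _
  have hstep : ∀ m n, m < n → n < I.card → θ (K - 1) - θ (e n) ≤ θ (K - 1) - θ (e m + 1) := by
    intro m n hmn hn
    have := (hI _ (he n hn)).1
    exact sub_le_sub_left (h.time_le (Nat.succ_le_of_lt (hlt m n hmn hn)) (by omega)) _
  have hhalf : ∀ n < I.card, 2 * (θ (K - 1) - θ (e n + 1)) ≤ θ (K - 1) - θ (e n) := fun n hn =>
    h.two_mul_sub_le (hI _ (he n hn)).1 (hI _ (he n hn)).2.2.1
  have hquarter : ∀ n, n + 3 < I.card → 4 * R (n + 3) ≤ R n := by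
    intro n hn
    have h1 := hR1 (n + 3) hn
    have h2 := hstep (n + 2) (n + 3) (by omega) hn
    have h3 := hhalf (n + 2) (by omega)
    have h4 := hstep (n + 1) (n + 2) (by omega) (by omega)
    have h5 := hhalf (n + 1) (by omega)
    have h6 := hstep n (n + 1) (by omega) (by omega)
    have h7 := hR2 n (by omega)
    linarith
  have hRnonneg : ∀ n < I.card, 0 ≤ R n := by
    intro n hn
    have := h.time_le (i := e n + 1) (j := K - 1) (by have := (hI _ (he n hn)).1; omega)
      (Nat.sub_le K 1)
    linarith [hR2 n hn]
  have hRpos : ∀ n, n + 1 < I.card → 0 < R n := by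
    intro n hn
    have h1 := h.time_lt (i := e (n + 1)) (j := K - 1)
      (by have := (hI _ (he (n + 1) hn)).1; omega) (Nat.sub_le K 1)
    linarith [hR2 n (by omega), hstep n (n + 1) (by omega) hn]
  set q := (I.card - 1) / 3 with hq
  have hdiff : ∀ n, ∑ a, ((y (e (3 * (n + 1))) a - y (e (3 * n)) a : ℤ) : ℝ) * N.transit a =
      ∑ a, y (e (3 * (n + 1))) a * N.transit a - ∑ a, y (e (3 * n)) a * N.transit a := by
    intro n
    rw [← Finset.sum_sub_distrib]
    exact Finset.sum_congr rfl fun a _ => by push_cast; ring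
  have hdiffR : ∀ n < q, ∑ a, ((y (e (3 * (n + 1))) a - y (e (3 * n)) a : ℤ) : ℝ) * N.transit a =
      R (3 * n) - R (3 * n + 3) := by
    intro n hn
    rw [hdiff, ← hty _ (he _ (by omega)), ← hty _ (he _ (by omega)), mul_add, mul_one]
    simp only [R]
    ring
  have hpow := two_pow_le_of_geometric (q := q) (B := 6) (c := N.transit)
    (x := fun n a => y (e (3 * (n + 1))) a - y (e (3 * n)) a) (fun n hn a => ?_) (fun n hn => ?_)
    (fun n hn => ?_)
  · have h1 := le_of_two_pow_le hpow
    have h2 : I.card ≤ 3 * q + 3 := by omega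
    have h3 : (I.card : ℝ) ≤ 3 * q + 3 := by exact_mod_cast h2
    linarith
  · have h1 := abs_le.1 (hy _ (he (3 * (n + 1)) (by omega)) a)
    have h2 := abs_le.1 (hy _ (he (3 * n) (by omega)) a)
    rw [abs_le]
    push_cast
    constructor <;> linarith [h1.1, h1.2, h2.1, h2.2]
  · rw [hdiffR n hn]
    have h1 := hquarter (3 * n) (by omega)
    have h2 := hRnonneg (3 * n + 3) (by omega)
    have h3 := hRpos (3 * n) (by omega)
    linarith
  · rw [hdiffR n (by omega), hdiffR (n + 1) hn]
    have h1 := hquarter (3 * n) (by omega)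
    have h2 := hRnonneg (3 * (n + 1) + 3) (by omega)
    rw [mul_add, mul_one] at h2 ⊢
    linarith [hRnonneg (3 * n + 3) (by omega)]

/-! ### The number of iterations -/

/-- Call an iteration exceptional if it is the first one or one of the last two, if it is of the
second kind, or if it separates a pair of terminals for the last time. Each iteration is followed by
an exceptional one within `2 * ⌈log₂ k⌉ + 1` steps. -/
lemma card_le (h : N.IsExecution b K θ θ' S) (hb : N.IsSupply b) (hk : 2 ≤ N.numTerminals) :
    (K : ℝ) ≤ ((N.numTerminals : ℝ) ^ 2 + 63 * (Fintype.card A * Real.log (Fintype.card A)) + 33) *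
      (2 * Nat.clog 2 N.numTerminals + 2) := by
  classical
  set L := 2 * Nat.clog 2 N.numTerminals + 1 with hL
  set I := (Finset.range K).filter fun i => i + 1 < K ∧ i ∈ N.iterations2 b K θ θ' S with hI
  set D := (Finset.range K).filter fun i => separated N K S (i + 1) ≠ separated N K S i with hD
  set P := ({0, K - 2, K - 1} : Finset ℕ) ∪ I ∪ D with hP
  have hPI := h.card_iterations2_le I fun i hi => (Finset.mem_filter.1 hi).2
  have hPD : D.card ≤ N.numTerminals ^ 2 := by
    have h1 : D.card + _ ≤ _ := card_drops_add_card_le (separated_anti N K S) K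
    have h2 := card_separated_le N K S 0
    omega
  have hPc : P.card ≤ 3 + I.card + D.card :=
    (Finset.card_union_le _ _).trans (Nat.add_le_add_right ((Finset.card_union_le _ _).trans
      (Nat.add_le_add_right Finset.card_le_three _)) _)
  have hreg : ∀ i < K, i ∉ P → 0 < i ∧ i + 2 < K ∧ i ∈ N.iterations3 b K θ θ' S ∧
      separated N K S (i + 1) = separated N K S i := by
    intro i hi hiP
    simp only [hP, Finset.mem_union, Finset.mem_insert, Finset.mem_singleton, not_or] at hiP
    obtain ⟨⟨⟨h1, h2, h3⟩, h4⟩, h5⟩ := hiP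
    have h6 : i + 2 < K := by omega
    have h7 : separated N K S (i + 1) = separated N K S i := by
      by_contra hne
      exact h5 (Finset.mem_filter.2 ⟨Finset.mem_range.2 hi, hne⟩)
    refine ⟨by omega, h6, ⟨hi, ?_⟩, h7⟩
    rintro (h8 | h8)
    · exact h.separated_ne_of_mem_iterations1 hb (by omega) h8 h7
    · exact h4 (Finset.mem_filter.2 ⟨Finset.mem_range.2 hi, by omega, h8⟩)
  have hcover : Finset.range K ⊆ P.biUnion fun p => Finset.Icc (p - L) p := by
    intro i hi
    rw [Finset.mem_range] at hi
    rw [Finset.mem_biUnion]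
    by_contra! hcon
    have hnot : ∀ n ≤ L, i + n ∉ P := fun n hn hp =>
      hcon (i + n) hp (Finset.mem_Icc.2 ⟨by omega, by omega⟩)
    have hlt : ∀ n ≤ L, i + n + 2 < K := by
      intro n
      induction n with
      | zero => intro _; exact (hreg i hi (hnot 0 (Nat.zero_le _))).2.1
      | succ n ih =>
        intro hn
        have := ih (by omega)
        exact (hreg (i + (n + 1)) (by omega) (hnot _ hn)).2.1
    have hrun : ∀ n ≤ L, _ := fun n hn => hreg (i + n) (by have := hlt n hn; omega) (hnot n hn)
    have hsep : ∀ n ≤ L, separated N K S (i + n) = separated N K S i := by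
      intro n
      induction n with
      | zero => intro _; rfl
      | succ n ih =>
        intro hn
        exact (hrun n (by omega)).2.2.2.trans (ih (by omega))
    exact h.separated_ne_of_run hb hk (hrun 0 (Nat.zero_le _)).1
      (by have := hlt L le_rfl; omega) (fun n hn => (hrun n hn).2.2.1) (hsep L le_rfl)
  have hK : K ≤ P.card * (L + 1) := by
    calc K = (Finset.range K).card := (Finset.card_range K).symm
      _ ≤ _ := Finset.card_le_card hcover
      _ ≤ P.card * (L + 1) := by
          refine Finset.card_biUnion_le_card_mul _ _ _ fun p _ => ?_
          rw [Nat.card_Icc]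
          omega
  have hK' : (K : ℝ) ≤ P.card * (L + 1) := by exact_mod_cast hK
  have hPc' : (P.card : ℝ) ≤ 3 + I.card + D.card := by exact_mod_cast hPc
  have hPD' : (D.card : ℝ) ≤ (N.numTerminals : ℝ) ^ 2 := by exact_mod_cast hPD
  have hL' : (L : ℝ) + 1 = 2 * Nat.clog 2 N.numTerminals + 2 := by rw [hL]; push_cast; ring
  rw [hL'] at hK'
  refine hK'.trans (mul_le_mul_of_nonneg_right ?_ (by positivity))
  linarith

/-- With at most one terminal, the only candidates for a minimizer have slack `0`. -/
lemma eq_zero_of_numTerminals_lt_two (h : N.IsExecution b K θ θ' S) (hb : N.IsSupply b)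
    (hk : N.numTerminals < 2) : K = 0 := by
  by_contra hK
  have h0 : 0 < K := Nat.pos_of_ne_zero hK
  have hneg := h.slack_neg h0
  have hθ := h.nonneg h0.le
  have hcard : S 0 = ∅ ∨ S 0 = N.terminals := by
    have hsub := h.subset 0 h0
    rcases Finset.eq_empty_or_nonempty (S 0) with h1 | h1
    · exact Or.inl h1
    · refine Or.inr (Finset.eq_of_subset_of_card_le hsub ?_)
      have := Finset.card_pos.2 h1
      unfold numTerminals at hk
      omega
  rcases hcard with h1 | h1 <;> rw [h1] at hneg
  · exact absurd (N.slack_empty b hθ) hneg.ne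
  · exact absurd (N.slack_terminals b hb hθ) hneg.ne

end IsExecution

end Network

lemma two_mul_clog_add_two_le {k : ℕ} (hk : 2 ≤ k) :
    (2 * Nat.clog 2 k + 2 : ℝ) ≤ 9 * Real.log k := by
  have hc : 0 < Nat.clog 2 k := Nat.clog_pos (by norm_num) hk
  have h1 : 2 ^ (Nat.clog 2 k).pred < k := Nat.pow_pred_clog_lt_self (by norm_num) hk
  have h2 : (2 : ℝ) ^ (Nat.clog 2 k).pred ≤ k := by exact_mod_cast h1.le
  have h3 := Real.log_le_log (by positivity) h2
  rw [Real.log_pow] at h3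
  have h4 : ((Nat.clog 2 k).pred : ℝ) = Nat.clog 2 k - 1 := by
    rw [Nat.pred_eq_sub_one, Nat.cast_sub hc, Nat.cast_one]
  rw [h4] at h3
  have h5 : Real.log 2 ≤ Real.log k := Real.log_le_log (by norm_num) (by exact_mod_cast hk)
  have h6 := Real.log_two_gt_d9
  have h7 : (1 : ℝ) ≤ Nat.clog 2 k := by exact_mod_cast hc
  nlinarith

end QuickestTransshipment

end

theorem mainTheorem3 :
    ∃ C : ℝ, ∀ (V A : Type*) [Fintype V] [DecidableEq V] [Fintype A]
      (N : QuickestTransshipment.Network V A) (b : V → ℝ), N.IsSupply b →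
      ∀ (K : ℕ) (θ θ' : ℕ → ℝ) (S : ℕ → Finset V), N.IsExecution b K θ θ' S →
        ((N.iterations3 b K θ θ' S).ncard : ℝ) ≤
          C * ((N.numTerminals : ℝ) ^ 2 * Real.log N.numTerminals +
            (Fintype.card A : ℝ) * Real.log (Fintype.card A) * Real.log N.numTerminals) := by
  refine ⟨567, fun V A _ _ _ N b hb K θ θ' S h => ?_⟩
  have hle : (N.iterations3 b K θ θ' S).ncard ≤ K := by
    have := Set.ncard_le_ncard (s := N.iterations3 b K θ θ' S) (t := (Finset.range K : Set ℕ))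
      (fun i hi => by simpa using hi.1) (Finset.finite_toSet _)
    rwa [Set.ncard_coe_finset, Finset.card_range] at this
  have hle' : ((N.iterations3 b K θ θ' S).ncard : ℝ) ≤ K := by exact_mod_cast hle
  refine hle'.trans ?_
  have hm : 0 ≤ (Fintype.card A : ℝ) * Real.log (Fintype.card A) :=
    mul_nonneg (Nat.cast_nonneg _) (Real.log_natCast_nonneg _)
  have hlk : 0 ≤ Real.log N.numTerminals := Real.log_natCast_nonneg _
  rcases Nat.lt_or_ge N.numTerminals 2 with hk | hk
  · rw [h.eq_zero_of_numTerminals_lt_two hb hk, Nat.cast_zero]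
    positivity
  · have h1 := h.card_le hb hk
    have h2 := QuickestTransshipment.two_mul_clog_add_two_le hk
    have hk2 : (2 : ℝ) ≤ N.numTerminals := by exact_mod_cast hk
    have hk4 : (4 : ℝ) ≤ (N.numTerminals : ℝ) ^ 2 := by nlinarith
    calc (K : ℝ) ≤ _ := h1
      _ ≤ (63 * ((N.numTerminals : ℝ) ^ 2 + Fintype.card A * Real.log (Fintype.card A))) *
          (9 * Real.log N.numTerminals) :=
        mul_le_mul (by linarith) h2 (by positivity) (by positivity)
      _ = _ := by ring
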